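/- **Setting.** Let $L\ge 1$. A Hermitian Pauli operator is $\pm$ a tensor product of single-qubit matrices $\mathbb 1,X,Y,Z$; it is supported on a set $S$ of qubits if all its tensor factors outside $S$ are $\mathbb 1$. Let $g_2,\dots,g_L$ be commuting, independent Hermitian Pauli operators on $L$ qubits generating a group $\mathcal G\not\ni -\mathbb 1$ (an $[[L,1]]$ stabilizer code), and let $\bar X,\bar Y,\bar Z$ be logical operators of the code: Hermitian Pauli operators commuting with $\mathcal G$ with $\bar X\bar Z=-\bar Z\bar X$ and $\bar Y=i\bar X\bar Z$. A logical operator $\bar\sigma$ is *reducible to* $S$ if $\bar\sigma s$ is supported on $S$ for some $s\in\mathcal G$. A member $g$ of an independent generating family of $\mathcal G$ is *reducible to* $S$ if $gs$ is supported on $S$ for some $s$ in the group generated by the other members. For a density matrix $\rho$ put $$\tilde{\mathcal M}_2(\rho)=-\log_2\frac{\sum_P \mathrm{Tr}[P\rho]^4}{\sum_P \mathrm{Tr}[P\rho]^2},$$ where $P$ runs over all Pauli strings with phase $+1$. **Theorem (bipartite magic gauge).** Let $|\psi\rangle$ be a pure $L$-qubit state with one unit of magic encoding one logical qubit, that is,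 $$\rho=|\psi\rangle\langle\psi|=\frac1{2^L}\Big(\mathbb 1+\frac{\bar Z-\bar Y}{\sqrt2}\Big)\prod_{j=2}^L(\mathbb 1+g_j).$$ Let $A$ be any set of qubits, $B$ its complement and $\rho_A=\mathrm{Tr}_B\,\rho$. 1. There are equivalent logical operators $\bar X'\in\bar X\mathcal G$, $\bar Y'\in\bar Y\mathcal G$, $\bar Z'\in\bar Z\mathcal G$ (again with $\bar X'\bar Z'=-\bar Z'\bar X'$ and $\bar Y'=i\bar X'\bar Z'$) and independent generators $a_1,\dots,a_{n_A},b_1,\dots,b_{n_B},h_1,\dots,h_m$ of $\mathcal G$, with $n_A+n_B+m=L-1$, such that $$\rho=\Big(\frac{\mathbb 1}{2}+\frac{\bar Z'-\bar Y'}{2\sqrt2}\Big)\prod_{i=1}^{n_A}\frac{\mathbb 1+a_i}{2}\prod_{j=1}^{n_B}\frac{\mathbb 1+b_j}{2}\prod_{k=1}^{m}\frac{\mathbb 1+h_k}{2}.$$ Each $a_i$ is supported on $A$ and not reducible to $B$; each $b_j$ is supported on $B$ and not reducible to $A$; each $h_k$ is reducible to neither $A$ nor $B$. For each $\bar\sigma\in\{\bar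 X,\bar Y,\bar Z\}$, the operator $\bar\sigma'$ is supported on $A$ if $\bar\sigma$ is reducible to $A$, and on $B$ if $\bar\sigma$ is reducible to $B$ but not to $A$. 2. Exactly one of the following five cases occurs, with the stated subsystem magic: - (i) $\bar Z$ and $\bar Y$ are both reducible to $A$, and neither is reducible to $B$: $\tilde{\mathcal M}_2(\rho_A)=\log_2(4/3)$. - (ii) $\bar Z$ and $\bar Y$ are both reducible to $B$, and neither is reducible to $A$: $\tilde{\mathcal M}_2(\rho_A)=0$. - (iii) neither $\bar Z$ nor $\bar Y$ is reducible to $A$ or to $B$: $\tilde{\mathcal M}_2(\rho_A)=0$. - (iv) $\bar Z$ is reducible to $A$ and to $B$, and $\bar Y$ to neither: $\tilde{\mathcal M}_2(\rho_A)=\log_2(6/5)$. - (v) $\bar Y$ is reducible to $A$ and to $B$, and $\bar Z$ to neither: $\tilde{\mathcal M}_2(\rho_A)=\log_2(6/5)$. -/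

import Mathlib

open scoped BigOperators Matrix

noncomputable section

namespace MagicGauge

/-- Operators on the qubits labelled by `ι`, as matrices in the computational basis. -/
abbrev Op (ι : Type*) : Type _ := Matrix (ι → Fin 2) (ι → Fin 2) ℂ

/-- Labels of the four single-qubit Pauli matrices. -/
inductive Pauli
  | I
  | X
  | Y
  | Z
  deriving DecidableEq

instance : Fintype Pauli :=
  ⟨{Pauli.I, Pauli.X, Pauli.Y, Pauli.Z}, by intro p; cases p <;> simp⟩

/-- The single-qubit Pauli matrices. -/
def Pauli.mat : Pauli → Matrix (Fin 2) (Fin 2) ℂ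
  | Pauli.I => 1
  | Pauli.X => !![0, 1; 1, 0]
  | Pauli.Y => !![0, -Complex.I; Complex.I, 0]
  | Pauli.Z => !![1, 0; 0, -1]

section Qubits

variable {ι : Type*} [Fintype ι] [DecidableEq ι]

/-- The Pauli string with phase `+1`: the tensor product over all qubits `i` of the single-qubit
Pauli matrices `P i`. -/
def pauliString (P : ι → Pauli) : Op ι :=
  Matrix.of fun x y => ∏ i, (P i).mat (x i) (y i)

/-- `M` is a Hermitian Pauli operator, i.e. plus or minus a Pauli string. -/
def IsHermitianPauli (M : Op ι) : Prop :=
  ∃ P : ι → Pauli, M = pauliString P ∨ M = -pauliString P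

/-- `M` is a Hermitian Pauli operator that acts as the identity on every qubit outside `S`. -/
def SupportedOn (S : Finset ι) (M : Op ι) : Prop :=
  ∃ P : ι → Pauli, (∀ i, i ∉ S → P i = Pauli.I) ∧ (M = pauliString P ∨ M = -pauliString P)

/-- The group generated by the operators `g k`. The generators considered below are involutions,
hence the multiplicative submonoid that they generate is already a group. -/
def stabGroup {κ : Type*} (g : κ → Op ι) : Submonoid (Op ι) :=
  Submonoid.closure (Set.range g)

/-- The group generated by all the operators `g l` with `l ≠ k`. -/
def stabGroupExcept {κ : Type*} (g : κ → Op ι) (k : κ) : Submonoid (Op ι) :=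
  Submonoid.closure (g '' {l | l ≠ k})

/-- `g` is a family of independent generators of a stabilizer group: commuting, independent
Hermitian Pauli operators that do not generate `-1`. -/
structure IsStabilizerGenerators {κ : Type*} (g : κ → Op ι) : Prop where
  pauli : ∀ k, IsHermitianPauli (g k)
  comm : ∀ k l, g k * g l = g l * g k
  independent : ∀ k, g k ∉ stabGroupExcept g k
  neg_one_notMem : (-1 : Op ι) ∉ stabGroup g

/-- `X, Y, Z` are the logical Pauli operators of a logical qubit of the stabilizer code with
stabilizer group `G`: Hermitian Pauli operators that commute with every stabilizer, where `X` and
`Z` anticommute and `Y = i X Z`. (As they anticommute pairwise, none of them is in `G` or `-G`.) -/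
structure IsLogicalTriple (G : Submonoid (Op ι)) (X Y Z : Op ι) : Prop where
  pauli_X : IsHermitianPauli X
  pauli_Y : IsHermitianPauli Y
  pauli_Z : IsHermitianPauli Z
  comm_X : ∀ s ∈ G, X * s = s * X
  comm_Y : ∀ s ∈ G, Y * s = s * Y
  comm_Z : ∀ s ∈ G, Z * s = s * Z
  anticomm : X * Z = -(Z * X)
  Y_eq : Y = Complex.I • (X * Z)

/-- The logical operator `σ` can be reduced to `S`: some equivalent logical operator `σ * s`, with
`s` a stabilizer, is supported on `S`. -/
def LogicalReducible (G : Submonoid (Op ι)) (S : Finset ι) (σ : Op ι) : Prop :=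
  ∃ s ∈ G, SupportedOn S (σ * s)

/-- The generator `g k` can be reduced to `S`: its product with some element of the group generated
by the other generators is supported on `S`. -/
def GeneratorReducible {κ : Type*} (g : κ → Op ι) (S : Finset ι) (k : κ) : Prop :=
  ∃ s ∈ stabGroupExcept g k, SupportedOn S (g k * s)

/-- `σ'` is a representative of the logical operator `σ` modulo stabilizers that is supported on
`A` if `σ` can be reduced to `A`, and otherwise on the complement of `A` if `σ` can be reduced to
that complement. -/
def IsGaugeRepresentative (G : Submonoid (Op ι)) (A : Finset ι) (σ σ' : Op ι) : Prop :=
  (∃ s ∈ G, σ' = σ * s) ∧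
  (LogicalReducible G A σ → SupportedOn A σ') ∧
  (¬ LogicalReducible G A σ → LogicalReducible G Aᶜ σ → SupportedOn Aᶜ σ')

/-- The basis state of all qubits that is `x` on the qubits in `A` and `z` on the others. -/
def glue (A : Finset ι) (x : {i // i ∈ A} → Fin 2) (z : {i // i ∉ A} → Fin 2) : ι → Fin 2 :=
  fun i => if h : i ∈ A then x ⟨i, h⟩ else z ⟨i, h⟩

/-- The reduced density matrix on `A`: the partial trace of `ρ` over the complement of `A`. -/
def reducedState (A : Finset ι) (ρ : Op ι) : Op {i // i ∈ A} :=
  Matrix.of fun x y => ∑ z : {i // i ∉ A} → Fin 2, ρ (glue A x z) (glue A y z)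

/-- The (normalized) stabilizer 2-Rényi entropy of a density matrix,
`-log₂ (∑_P Tr[P ρ]⁴ / ∑_P Tr[P ρ]²)`, where `P` runs over all Pauli strings with phase `+1`. The
traces are real as `ρ` is Hermitian. -/
def magic (ρ : Op ι) : ℝ :=
  -Real.logb 2
    ((∑ P : ι → Pauli, (Matrix.trace (pauliString P * ρ)).re ^ 4) /
      (∑ P : ι → Pauli, (Matrix.trace (pauliString P * ρ)).re ^ 2))

end Qubits

end MagicGauge

end

open MagicGauge

/-!
The subgroups `G_A` and `G_B` of stabilizers supported on `A` and on `B` meet only in `1`, and `G`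
is an `𝔽₂`-vector space, so bases of `G_A` and `G_B` jointly extend to a basis of `G`; such a basis
consists of the generators `a`, `b` and `h`. Operators supported on `A` commute with operators
supported on `B`, so if a logical operator is reducible to `A`, then those anticommuting with it are
not reducible to `B`. Hence `X'`, `Y'` and `Z'` are never required to lie on different sides. If
`X'` and `Z'` are chosen on the same side, then so is `Y' = i X' Z'`; otherwise one of `X'` and `Z'`
is free and can be adjusted to put `Y'` where it belongs.

Expanding the state, the Pauli strings supported on `A` with nonzero expectation value are, up to
sign, the products `σ s` supported on `A` with `σ ∈ {1, Z, Y}` and `s ∈ G`. If `r_A` of `Z` and `Y`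
are reducible to `A`, there are `|G_A|` of these with value `±1` and `r_A |G_A|` with value `±1/√2`,
so the magic of `ρ_A` is `log₂ ((4 + 2 r_A) / (4 + r_A))`. For a pure state `ρ_A` and `ρ_B` have the
same purity, which makes `|G_A| (2 + r_A)` and `|G_B| (2 + r_B)` agree up to a power of `2`; hence
`r_A = 1` if and only if `r_B = 1`. Together with the anticommutation of `Y` and `Z`, this leaves
only the five cases.
-/

noncomputable section

namespace MagicGauge

section ElementaryAbelian

open Multiplicative Submonoid

universe u

variable {M : Type u} [Monoid M]

theorem mul_comm_of_mem_closure {S : Set M} (comm : ∀ x ∈ S, ∀ y ∈ S, x * y = y * x) {x y : M}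
    (hx : x ∈ closure S) (hy : y ∈ closure S) : x * y = y * x :=
  congrArg Subtype.val ((isMulCommutative_closure M comm).is_comm.comm ⟨x, hx⟩ ⟨y, hy⟩)

theorem mul_self_of_mem_closure {S : Set M} (comm : ∀ x ∈ S, ∀ y ∈ S, x * y = y * x)
    (sq : ∀ x ∈ S, x * x = 1) {x : M} (hx : x ∈ closure S) : x * x = 1 := by
  induction hx using closure_induction with
  | mem x hx => exact sq x hx
  | one => exact one_mul 1
  | mul x y hx hy ihx ihy =>
    rw [mul_assoc, ← mul_assoc y, mul_comm_of_mem_closure comm hy hx, mul_assoc x y, ihy, mul_one,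
      ihx]

theorem exists_zmod_two_module (G : Submonoid M) (comm : ∀ x ∈ G, ∀ y ∈ G, x * y = y * x)
    (sq : ∀ x ∈ G, x * x = 1) :
    ∃ (V : Type u) (_ : AddCommGroup V) (_ : Module (ZMod 2) V) (f : Multiplicative V →* M),
      Function.Injective f ∧ MonoidHom.mrange f = G := by
  let _ : CommGroup G :=
    { (inferInstance : Monoid G) with
      inv := id
      inv_mul_cancel := fun x => Subtype.ext (sq x x.2)
      mul_comm := fun x y => Subtype.ext (comm x x.2 y y.2) }
  have two_nsmul_eq_zero (x : Additive G) : 2 • x = 0 := by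
    rw [two_nsmul]
    exact Subtype.ext (sq x.toMul x.toMul.2)
  let f : Multiplicative (Additive G) →* M :=
    G.subtype.comp (MulEquiv.multiplicativeAdditive G).toMonoidHom
  refine ⟨Additive G, inferInstance, AddCommGroup.zmodModule two_nsmul_eq_zero, f,
    Subtype.val_injective.comp (MulEquiv.multiplicativeAdditive G).injective, ?_⟩
  ext x
  exact ⟨fun ⟨v, hv⟩ => hv ▸ v.toAdd.toMul.2, fun hx => ⟨ofAdd (Additive.ofMul ⟨x, hx⟩), rfl⟩⟩

/-- The elements `g k` are commuting involutions none of which lies in the group generated by the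
others, i.e. an independent generating family of an elementary abelian 2-group. -/
structure IsIndepInvolutions {κ : Type*} (g : κ → M) : Prop where
  comm : ∀ k l, g k * g l = g l * g k
  mul_self : ∀ k, g k * g k = 1
  independent : ∀ k, g k ∉ closure (g '' {l | l ≠ k})

section Linear

variable {V : Type*} [AddCommGroup V] [Module (ZMod 2) V]

/-- The subgroup of `M` that corresponds to a subspace of `V`, where `f` identifies `V` with an
elementary abelian 2-group in `M`. -/
def subspaceImage (f : Multiplicative V →* M) (U : Submodule (ZMod 2) V) : Submonoid M :=
  (AddSubmonoid.toSubmonoid U.toAddSubmonoid).map f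

theorem mem_subspaceImage {f : Multiplicative V →* M} {U : Submodule (ZMod 2) V} {x : M} :
    x ∈ subspaceImage f U ↔ ∃ v ∈ U, f (ofAdd v) = x :=
  Iff.rfl

theorem subspaceImage_top (f : Multiplicative V →* M) :
    subspaceImage f ⊤ = MonoidHom.mrange f := by
  ext x
  simp only [mem_subspaceImage, Submodule.mem_top, true_and]
  rfl

theorem mem_of_mem_span_zmod_two {f : Multiplicative V →* M} {N : Submonoid M} {S : Set V}
    (hS : ∀ v ∈ S, f (ofAdd v) ∈ N) {v : V} (hv : v ∈ Submodule.span (ZMod 2) S) :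
    f (ofAdd v) ∈ N := by
  induction hv using Submodule.span_induction with
  | mem v hv => exact hS v hv
  | zero => exact (map_one f).symm ▸ one_mem N
  | add v w _ _ ihv ihw => exact (map_mul f (ofAdd v) (ofAdd w)).symm ▸ mul_mem ihv ihw
  | smul c v _ ih =>
    obtain rfl | rfl : c = 0 ∨ c = 1 := by revert c; decide
    · exact (zero_smul (ZMod 2) v).symm ▸ (map_one f).symm ▸ one_mem N
    · rwa [one_smul]

theorem closure_image_ofAdd (f : Multiplicative V →* M) (S : Set V) :
    closure ((fun v => f (ofAdd v)) '' S) = subspaceImage f (Submodule.span (ZMod 2) S) := by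
  apply le_antisymm
  · rw [closure_le]
    rintro _ ⟨v, hv, rfl⟩
    exact mem_subspaceImage.2 ⟨v, Submodule.subset_span hv, rfl⟩
  · rintro _ ⟨v, hv, rfl⟩
    have subset_closure : ∀ w ∈ S, f (ofAdd w) ∈ closure ((fun v => f (ofAdd v)) '' S) :=
      fun w hw => Submonoid.subset_closure ⟨w, hw, rfl⟩
    exact mem_of_mem_span_zmod_two subset_closure hv

theorem closure_range_ofAdd (f : Multiplicative V →* M) {κ : Type*} (v : κ → V) :
    closure (Set.range fun k => f (ofAdd (v k))) =
      subspaceImage f (Submodule.span (ZMod 2) (Set.range v)) := by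
  rw [← closure_image_ofAdd, ← Set.range_comp]
  rfl

theorem exists_eq_subspaceImage {f : Multiplicative V →* M} {N : Submonoid M}
    (hN : N ≤ MonoidHom.mrange f) : ∃ U, N = subspaceImage f U := by
  refine ⟨Submodule.span (ZMod 2) {v | f (ofAdd v) ∈ N}, le_antisymm (fun x hx => ?_) ?_⟩
  · obtain ⟨v, rfl⟩ := hN hx
    exact mem_subspaceImage.2 ⟨v.toAdd, Submodule.subset_span hx, rfl⟩
  · rintro _ ⟨v, hv, rfl⟩
    exact mem_of_mem_span_zmod_two (fun w hw => hw) hv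

theorem mem_closure_image_iff {f : Multiplicative V →* M} (hf : Function.Injective f) {S : Set V}
    {v : V} : f (ofAdd v) ∈ closure ((fun w => f (ofAdd w)) '' S) ↔
      v ∈ Submodule.span (ZMod 2) S := by
  simp only [closure_image_ofAdd, mem_subspaceImage, hf.eq_iff, EmbeddingLike.apply_eq_iff_eq,
    exists_eq_right]

theorem isIndepInvolutions_comp_iff {f : Multiplicative V →* M} (hf : Function.Injective f)
    {κ : Type*} (v : κ → V) :
    IsIndepInvolutions (fun k => f (ofAdd (v k))) ↔ LinearIndependent (ZMod 2) v := by
  have image_eq (k : κ) : (fun l => f (ofAdd (v l))) '' {l | l ≠ k} =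
      (fun w => f (ofAdd w)) '' (v '' (Set.univ \ {k})) := by
    rw [Set.image_image, ← Set.compl_eq_univ_sdiff]
    rfl
  rw [linearIndependent_iff_notMem_span]
  refine ⟨fun h k => ?_, fun h => ⟨fun k l => ?_, fun k => ?_, fun k => ?_⟩⟩
  · rw [← mem_closure_image_iff hf, ← image_eq]
    exact h.independent k
  · rw [← map_mul, mul_comm, map_mul]
  · rw [← map_mul, ← ofAdd_add, ← two_smul (ZMod 2), show (2 : ZMod 2) = 0 from rfl, zero_smul,
      ofAdd_zero, map_one]
  · rw [image_eq, mem_closure_image_iff hf]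
    exact h k

end Linear

theorem IsIndepInvolutions.exists_basis {κ : Type*} {g : κ → M} (hg : IsIndepInvolutions g) :
    ∃ (V : Type u) (_ : AddCommGroup V) (_ : Module (ZMod 2) V) (f : Multiplicative V →* M)
      (v : Module.Basis κ (ZMod 2) V), Function.Injective f ∧
      MonoidHom.mrange f = closure (Set.range g) ∧ ∀ k, f (ofAdd (v k)) = g k := by
  have comm : ∀ x ∈ Set.range g, ∀ y ∈ Set.range g, x * y = y * x := by
    rintro _ ⟨k, rfl⟩ _ ⟨l, rfl⟩
    exact hg.comm k l
  have sq : ∀ x ∈ Set.range g, x * x = 1 := by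
    rintro _ ⟨k, rfl⟩
    exact hg.mul_self k
  obtain ⟨V, _, _, f, hf, range_f⟩ := exists_zmod_two_module (closure (Set.range g))
    (fun x hx y hy => mul_comm_of_mem_closure comm hx hy)
    (fun x hx => mul_self_of_mem_closure comm sq hx)
  have (k : κ) : ∃ v : V, f (ofAdd v) = g k := by
    have : g k ∈ MonoidHom.mrange f := range_f ▸ subset_closure ⟨k, rfl⟩
    exact this
  choose v hv using this
  obtain rfl : (fun k => f (ofAdd (v k))) = g := funext hv
  refine ⟨V, _, _, f, Module.Basis.mk ((isIndepInvolutions_comp_iff hf v).1 hg) fun w _ => ?_,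
    hf, range_f, fun k => by rw [Module.Basis.mk_apply]⟩
  rw [← mem_closure_image_iff hf, ← Set.range_comp]
  exact range_f ▸ ⟨ofAdd w, rfl⟩

theorem IsIndepInvolutions.natCard_closure {κ : Type*} [Fintype κ] {g : κ → M}
    (hg : IsIndepInvolutions g) : Nat.card (closure (Set.range g)) = 2 ^ Fintype.card κ := by
  obtain ⟨V, _, _, f, v, hf, range_f, -⟩ := hg.exists_basis
  have : Module.Finite (ZMod 2) V := .of_basis v
  calc Nat.card (closure (Set.range g)) = Nat.card (MonoidHom.mrange f) := by rw [range_f]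
    _ = Nat.card V := Nat.card_range_of_injective hf
    _ = 2 ^ Fintype.card κ := by
      rw [Module.natCard_eq_pow_finrank (K := ZMod 2), Module.finrank_eq_card_basis v,
        Nat.card_zmod]

theorem exists_natCard_eq_two_pow (G : Submonoid M) [Finite G]
    (comm : ∀ x ∈ G, ∀ y ∈ G, x * y = y * x) (sq : ∀ x ∈ G, x * x = 1) :
    ∃ n, Nat.card G = 2 ^ n := by
  obtain ⟨V, _, _, f, hf, range_f⟩ := exists_zmod_two_module G comm sq
  have card : Nat.card G = Nat.card V :=
    (congrArg (fun H : Submonoid M => Nat.card H) range_f.symm).trans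
      (Nat.card_range_of_injective hf)
  have : Finite V := Nat.finite_of_card_ne_zero (card ▸ Nat.card_pos.ne')
  exact ⟨_, by rw [card, Module.natCard_eq_pow_finrank (K := ZMod 2), Nat.card_zmod]⟩

theorem exists_adapted_basis {K V : Type*} [DivisionRing K] [AddCommGroup V] [Module K V]
    [Module.Finite K V] {U W : Submodule K V} (h : Disjoint U W) :
    ∃ (nU nW m : ℕ) (v : Module.Basis (Fin nU ⊕ Fin nW ⊕ Fin m) K V),
      Submodule.span K (Set.range fun i => v (Sum.inl i)) = U ∧
      Submodule.span K (Set.range fun j => v (Sum.inr (Sum.inl j))) = W := by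
  obtain ⟨C, hC⟩ := (U ⊔ W).exists_isCompl
  have span_basis {n : ℕ} {T : Submodule K V} (b : Module.Basis (Fin n) K T) :
      Submodule.span K (Set.range fun i => (b i : V)) = T := by
    have := congrArg (Submodule.map T.subtype) b.span_eq
    rwa [Submodule.map_span, Submodule.map_top, Submodule.range_subtype, ← Set.range_comp] at this
  have indep_basis {n : ℕ} {T : Submodule K V} (b : Module.Basis (Fin n) K T) :
      LinearIndependent K fun i => (b i : V) :=
    b.linearIndependent.map' T.subtype T.ker_subtype
  let u := Module.finBasis K U
  let w := Module.finBasis K W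
  let c := Module.finBasis K C
  let v := Sum.elim (fun i => (u i : V)) (Sum.elim (fun i => (w i : V)) fun i => (c i : V))
  have v_indep : LinearIndependent K v := by
    refine (indep_basis u).sum_type ((indep_basis w).sum_type (indep_basis c) ?_) ?_
    · rw [span_basis, span_basis]
      exact hC.disjoint.mono_left le_sup_right
    · rw [Set.Sum.elim_range, Submodule.span_union, span_basis, span_basis, span_basis]
      exact h.disjoint_sup_right_of_disjoint_sup_left hC.disjoint
  have v_span : Submodule.span K (Set.range v) = ⊤ := by
    rw [Set.Sum.elim_range, Set.Sum.elim_range, Submodule.span_union, Submodule.span_union,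
      span_basis, span_basis, span_basis, ← sup_assoc, hC.sup_eq_top]
  refine ⟨_, _, _, .mk v_indep v_span.ge, ?_, ?_⟩
  · simp only [Module.Basis.mk_apply]
    exact span_basis u
  · simp only [Module.Basis.mk_apply]
    exact span_basis w

theorem IsIndepInvolutions.exists_adapted {κ : Type*} [Fintype κ] {g : κ → M}
    (hg : IsIndepInvolutions g) {H K : Submonoid M} (hH : H ≤ closure (Set.range g))
    (hK : K ≤ closure (Set.range g)) (hHK : ∀ x ∈ H, x ∈ K → x = 1) :
    ∃ (nH nK m : ℕ) (a : Fin nH → M) (b : Fin nK → M) (h : Fin m → M),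
      Fintype.card κ = nH + nK + m ∧
      IsIndepInvolutions (Sum.elim a (Sum.elim b h)) ∧
      closure (Set.range (Sum.elim a (Sum.elim b h))) = closure (Set.range g) ∧
      closure (Set.range a) = H ∧ closure (Set.range b) = K := by
  obtain ⟨V, _, _, f, v, hf, range_f, -⟩ := hg.exists_basis
  have : Module.Finite (ZMod 2) V := .of_basis v
  obtain ⟨U, rfl⟩ := exists_eq_subspaceImage (range_f ▸ hH)
  obtain ⟨W, rfl⟩ := exists_eq_subspaceImage (range_f ▸ hK)
  have hUW : Disjoint U W := Submodule.disjoint_def.2 fun w hwU hwW =>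
    ofAdd.injective <| hf <| (hHK _ ⟨w, hwU, rfl⟩ ⟨w, hwW, rfl⟩).trans (map_one f).symm
  obtain ⟨nH, nK, m, w, span_a, span_b⟩ := exists_adapted_basis hUW
  let a i := f (ofAdd (w (Sum.inl i)))
  let b j := f (ofAdd (w (Sum.inr (Sum.inl j))))
  let h k := f (ofAdd (w (Sum.inr (Sum.inr k))))
  have elim_eq : Sum.elim a (Sum.elim b h) = fun k => f (ofAdd (w k)) := by
    ext (k | k | k) <;> rfl
  refine ⟨nH, nK, m, a, b, h, ?_, ?_, ?_, ?_, ?_⟩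
  · have := Module.finrank_eq_card_basis w
    rw [Module.finrank_eq_card_basis v] at this
    simpa [add_assoc] using this
  · rw [elim_eq, isIndepInvolutions_comp_iff hf]
    exact w.linearIndependent
  · rw [elim_eq, closure_range_ofAdd, w.span_eq, subspaceImage_top, range_f]
  · rw [← span_a, ← closure_range_ofAdd]
  · rw [← span_b, ← closure_range_ofAdd]

end ElementaryAbelian

section Projector

variable {R : Type*}

/-- The sum of the elements of a finite group `G` in a ring. For a stabilizer group it is the
projector onto the code space up to normalization. If `G` is infinite, the sum is `0` by
convention. -/
def elementSum [Semiring R] (G : Submonoid R) : R :=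
  ∑ᶠ s : G, (s : R)

theorem elementSum_mul [Semiring R] (G : Submonoid R) [Finite G] {x : R} (hx : x ∈ G)
    (sq : x * x = 1) : elementSum G * x = elementSum G := by
  have := Fintype.ofFinite G
  have mul_involutive : Function.Involutive fun s : G => s * ⟨x, hx⟩ := fun s =>
    Subtype.ext (by simp [mul_assoc, sq])
  rw [elementSum, finsum_eq_sum_of_fintype, Finset.sum_mul]
  exact Fintype.sum_bijective _ mul_involutive.bijective _ _ fun s => rfl

theorem mul_elementSum [Semiring R] (G : Submonoid R) [Finite G] {x : R} (hx : x ∈ G)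
    (sq : x * x = 1) : x * elementSum G = elementSum G := by
  have := Fintype.ofFinite G
  have mul_involutive : Function.Involutive fun s : G => ⟨x, hx⟩ * s := fun s =>
    Subtype.ext (by simp [← mul_assoc, sq])
  rw [elementSum, finsum_eq_sum_of_fintype, Finset.mul_sum]
  exact Fintype.sum_bijective _ mul_involutive.bijective _ _ fun s => rfl

theorem elementSum_mul_prod_one_add [Semiring R] (G : Submonoid R) [Finite G] {l : List R}
    (hl : ∀ x ∈ l, x ∈ G) (sq : ∀ x ∈ l, x * x = 1) :
    elementSum G * (l.map (1 + ·)).prod = 2 ^ l.length • elementSum G := by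
  induction l with
  | nil => simp
  | cons y t ih =>
    rw [List.forall_mem_cons] at hl sq
    rw [List.map_cons, List.prod_cons, ← mul_assoc, mul_add, mul_one, elementSum_mul G hl.1 sq.1,
      ← two_nsmul, smul_mul_assoc, ih hl.2 sq.2, smul_smul, List.length_cons, pow_succ']

theorem mul_prod_one_add_of_mem [Semiring R] {l : List R}
    (comm : ∀ x ∈ l, ∀ y ∈ l, x * y = y * x) (sq : ∀ x ∈ l, x * x = 1) {x : R} (hx : x ∈ l) :
    x * (l.map (1 + ·)).prod = (l.map (1 + ·)).prod := by
  induction l with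
  | nil => exact absurd hx List.not_mem_nil
  | cons y t ih =>
    have comm_t : ∀ a ∈ t, ∀ b ∈ t, a * b = b * a := fun a ha b hb =>
      comm a (List.mem_cons_of_mem y ha) b (List.mem_cons_of_mem y hb)
    rw [List.map_cons, List.prod_cons, ← mul_assoc, mul_add, mul_one]
    rcases List.mem_cons.1 hx with rfl | hxt
    · rw [sq x hx, add_comm]
    · rw [comm x hx y List.mem_cons_self, ← one_add_mul, mul_assoc,
        ih comm_t (fun a ha => sq a (List.mem_cons_of_mem y ha)) hxt]

-- Averaging the product over the group generated by the `g k` in two ways yields `2 ^ n` times the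
-- product and `2 ^ n` times the sum of the group elements.
theorem IsIndepInvolutions.prod_one_add [Semiring R] [IsAddTorsionFree R] {κ : Type*} [Fintype κ]
    {g : κ → R} (hg : IsIndepInvolutions g) {l : List R} (mem_l : ∀ x, x ∈ l ↔ x ∈ Set.range g)
    (length_l : l.length = Fintype.card κ) :
    (l.map (1 + ·)).prod = elementSum (Submonoid.closure (Set.range g)) := by
  have comm : ∀ x ∈ l, ∀ y ∈ l, x * y = y * x := by
    simp only [mem_l]
    rintro _ ⟨k, rfl⟩ _ ⟨k', rfl⟩
    exact hg.comm k k'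
  have sq : ∀ x ∈ l, x * x = 1 := by
    simp only [mem_l]
    rintro _ ⟨k, rfl⟩
    exact hg.mul_self k
  have absorb {x : R} (hx : x ∈ Submonoid.closure (Set.range g)) :
      x * (l.map (1 + ·)).prod = (l.map (1 + ·)).prod := by
    induction hx using Submonoid.closure_induction with
    | mem x hx => exact mul_prod_one_add_of_mem comm sq ((mem_l x).2 hx)
    | one => exact one_mul _
    | mul x y _ _ hx hy => rw [mul_assoc, hy, hx]
  have card := hg.natCard_closure
  have : Finite (Submonoid.closure (Set.range g)) := Nat.finite_of_card_ne_zero (by simp [card])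
  have := Fintype.ofFinite (Submonoid.closure (Set.range g))
  have average : elementSum (Submonoid.closure (Set.range g)) * (l.map (1 + ·)).prod =
      2 ^ l.length • (l.map (1 + ·)).prod := by
    rw [elementSum, finsum_eq_sum_of_fintype, Finset.sum_mul,
      Finset.sum_congr rfl fun s _ => absorb s.2, Finset.sum_const, Finset.card_univ,
      ← Nat.card_eq_fintype_card, card, length_l]
  rw [elementSum_mul_prod_one_add _ (fun x hx => Submonoid.subset_closure ((mem_l x).1 hx)) sq]
    at average
  exact (nsmul_right_injective (pow_ne_zero _ two_ne_zero) average).symm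

theorem IsIndepInvolutions.prod_ofFn_one_add [Semiring R] [IsAddTorsionFree R] {n : ℕ}
    {g : Fin n → R} (hg : IsIndepInvolutions g) :
    (List.ofFn fun k => 1 + g k).prod = elementSum (Submonoid.closure (Set.range g)) := by
  rw [← hg.prod_one_add (l := List.ofFn g) (List.mem_ofFn' g) (by simp), List.map_ofFn]
  rfl

instance {m n : Type*} [AddMonoid R] [IsAddTorsionFree R] : IsAddTorsionFree (Matrix m n R) :=
  Pi.instIsAddTorsionFree

theorem prod_ofFn_smul {S : Type*} [CommMonoid S] [Monoid R] [MulAction S R] [IsScalarTower S R R]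
    [SMulCommClass S R R] (c : S) {n : ℕ} (f : Fin n → R) :
    (List.ofFn fun i => c • f i).prod = c ^ n • (List.ofFn f).prod := by
  induction n with
  | zero => simp
  | succ n ih =>
    rw [List.ofFn_succ, List.ofFn_succ, List.prod_cons, List.prod_cons, ih, smul_mul_smul_comm,
      pow_succ']

theorem IsIndepInvolutions.prod_ofFn_smul_one_add {S : Type*} [CommMonoid S] [Semiring R]
    [IsAddTorsionFree R] [MulAction S R] [IsScalarTower S R R] [SMulCommClass S R R] (c : S)
    {p q r : ℕ} {a : Fin p → R} {b : Fin q → R} {h : Fin r → R}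
    (hg : IsIndepInvolutions (Sum.elim a (Sum.elim b h))) :
    (List.ofFn fun i => c • (1 + a i)).prod * (List.ofFn fun j => c • (1 + b j)).prod *
        (List.ofFn fun k => c • (1 + h k)).prod =
      c ^ (p + q + r) •
        elementSum (Submonoid.closure (Set.range (Sum.elim a (Sum.elim b h)))) := by
  have mem_append (x : R) : x ∈ List.ofFn a ++ List.ofFn b ++ List.ofFn h ↔
      x ∈ Set.range (Sum.elim a (Sum.elim b h)) := by
    simp only [List.mem_append, List.mem_ofFn', Set.Sum.elim_range, Set.mem_union, or_assoc]
  rw [prod_ofFn_smul, prod_ofFn_smul, prod_ofFn_smul, smul_mul_smul_comm, smul_mul_smul_comm,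
    ← pow_add, ← pow_add, ← hg.prod_one_add mem_append (by simp)]
  simp only [List.map_append, List.prod_append, List.map_ofFn]
  rfl

end Projector

section Tensor

variable {ι R : Type*} [Fintype ι] [CommSemiring R] {n : ι → Type*}

/-- The tensor product of the matrices `M i`, indexed by the tuples of indices of the factors. -/
def tensorProd (M : ∀ i, Matrix (n i) (n i) R) : Matrix (∀ i, n i) (∀ i, n i) R :=
  Matrix.of fun x y => ∏ i, M i (x i) (y i)

theorem tensorProd_smul (c : ι → R) (M : ∀ i, Matrix (n i) (n i) R) :
    tensorProd (fun i => c i • M i) = (∏ i, c i) • tensorProd M := by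
  ext x y
  exact Finset.prod_mul_distrib

theorem tensorProd_one [∀ i, DecidableEq (n i)] :
    tensorProd (fun i => (1 : Matrix (n i) (n i) R)) = 1 := by
  ext x y
  simp only [tensorProd, Matrix.of_apply, Matrix.one_apply, Finset.prod_ite_zero,
    Finset.prod_const_one, Finset.mem_univ, true_implies, funext_iff]

variable [DecidableEq ι] [∀ i, Fintype (n i)]

theorem tensorProd_mul (M N : ∀ i, Matrix (n i) (n i) R) :
    tensorProd M * tensorProd N = tensorProd fun i => M i * N i := by
  ext x z
  simp only [Matrix.mul_apply, tensorProd, Matrix.of_apply, ← Finset.prod_mul_distrib]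
  exact (Fintype.prod_sum fun i j => M i (x i) j * N i j (z i)).symm

theorem trace_tensorProd (M : ∀ i, Matrix (n i) (n i) R) :
    (tensorProd M).trace = ∏ i, (M i).trace :=
  (Fintype.prod_sum fun i j => M i j j).symm

end Tensor

section Pauli

/-- The product of two Pauli labels, up to phase. -/
def Pauli.mul : Pauli → Pauli → Pauli
  | .I, q => q
  | p, .I => p
  | .X, .X => .I
  | .Y, .Y => .I
  | .Z, .Z => .I
  | .X, .Y => .Z
  | .Y, .X => .Z
  | .Y, .Z => .X
  | .Z, .Y => .X
  | .Z, .X => .Y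
  | .X, .Z => .Y

/-- The phase in the product of two Pauli matrices. -/
def Pauli.phase : Pauli → Pauli → ℂ
  | .X, .Y => Complex.I
  | .Y, .X => -Complex.I
  | .Y, .Z => Complex.I
  | .Z, .Y => -Complex.I
  | .Z, .X => Complex.I
  | .X, .Z => -Complex.I
  | _, _ => 1

theorem Pauli.mat_mul_mat (p q : Pauli) : p.mat * q.mat = phase p q • (mul p q).mat := by
  cases p <;> cases q <;> ext i j <;> fin_cases i <;> fin_cases j <;>
    simp [Pauli.mat, Pauli.mul, Pauli.phase, Matrix.mul_apply]

theorem Pauli.mat_mul_self (p : Pauli) : p.mat * p.mat = 1 := by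
  rw [mat_mul_mat]
  cases p <;> exact one_smul ℂ 1

theorem Pauli.trace_mat_mul_mat (p q : Pauli) :
    (p.mat * q.mat).trace = if p = q then 2 else 0 := by
  rw [mat_mul_mat]
  cases p <;> cases q <;> simp [mat, mul, phase, Matrix.trace]

theorem Pauli.sum_mat_mul_mat (x y z w : Fin 2) :
    ∑ p : Pauli, p.mat x y * p.mat z w = if x = w ∧ y = z then 2 else 0 := by
  have sum_pauli (f : Pauli → ℂ) : ∑ p, f p = f .I + (f .X + (f .Y + f .Z)) := by
    change Finset.sum {Pauli.I, Pauli.X, Pauli.Y, Pauli.Z} f = _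
    simp
  rw [sum_pauli]
  fin_cases x <;> fin_cases y <;> fin_cases z <;> fin_cases w <;> norm_num [mat]

variable {ι : Type*} [Fintype ι]

theorem pauliString_I : pauliString (fun _ : ι => Pauli.I) = 1 :=
  tensorProd_one

theorem supportedOn_univ_iff {M : Op ι} : SupportedOn Finset.univ M ↔ IsHermitianPauli M := by
  simp [SupportedOn, IsHermitianPauli]

theorem SupportedOn.isHermitianPauli {S : Finset ι} {M : Op ι} (hM : SupportedOn S M) :
    IsHermitianPauli M :=
  let ⟨P, _, h⟩ := hM
  ⟨P, h⟩

theorem supportedOn_one (S : Finset ι) : SupportedOn S (1 : Op ι) :=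
  ⟨fun _ => Pauli.I, fun _ _ => rfl, Or.inl pauliString_I.symm⟩

theorem finite_setOf_isHermitianPauli : {M : Op ι | IsHermitianPauli M}.Finite := by
  refine ((Set.finite_range pauliString).union (Set.finite_range (-pauliString))).subset ?_
  rintro M ⟨P, rfl | rfl⟩
  exacts [Or.inl ⟨P, rfl⟩, Or.inr ⟨P, rfl⟩]

theorem IsHermitianPauli.exists_smul {M : Op ι} (hM : IsHermitianPauli M) :
    ∃ (P : ι → Pauli) (c : ℂ), c * c = 1 ∧ M = c • pauliString P := by
  obtain ⟨P, rfl | rfl⟩ := hM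
  exacts [⟨P, 1, by simp⟩, ⟨P, -1, by simp⟩]

theorem pauliString_mul [DecidableEq ι] (P Q : ι → Pauli) :
    pauliString P * pauliString Q =
      (∏ i, (P i).phase (Q i)) • pauliString fun i => (P i).mul (Q i) := by
  refine (tensorProd_mul _ _).trans ?_
  simp only [Pauli.mat_mul_mat]
  exact tensorProd_smul _ _

theorem pauliString_mul_self [DecidableEq ι] (P : ι → Pauli) :
    pauliString P * pauliString P = 1 := by
  refine (tensorProd_mul _ _).trans ?_
  simp only [Pauli.mat_mul_self]
  exact tensorProd_one

theorem trace_pauliString_mul [DecidableEq ι] (P Q : ι → Pauli) :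
    (pauliString P * pauliString Q).trace = if P = Q then 2 ^ Fintype.card ι else 0 := by
  refine (congrArg Matrix.trace (tensorProd_mul _ _)).trans ?_
  simp only [trace_tensorProd, Pauli.trace_mat_mul_mat, Finset.prod_ite_zero, funext_iff]
  simp

theorem eq_of_smul_pauliString_eq {P Q : ι → Pauli} {c d : ℂ} (hc : c ≠ 0)
    (h : c • pauliString P = d • pauliString Q) : P = Q := by
  classical
  by_contra hne
  have := congrArg (fun M => (pauliString P * M).trace) h
  simp [trace_pauliString_mul, hne, hc] at this

variable [DecidableEq ι]

/-- The labels of the Pauli strings that act as the identity outside `S`. -/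
def supportedStrings (S : Finset ι) : Finset (ι → Pauli) :=
  Fintype.piFinset fun i => if i ∈ S then Finset.univ else {Pauli.I}

theorem mem_supportedStrings {S : Finset ι} {P : ι → Pauli} :
    P ∈ supportedStrings S ↔ ∀ i, i ∉ S → P i = Pauli.I := by
  simp only [supportedStrings, Fintype.mem_piFinset]
  refine forall_congr' fun i => ?_
  by_cases hi : i ∈ S <;> simp [hi]

theorem supportedOn_iff {S : Finset ι} {M : Op ι} :
    SupportedOn S M ↔
      ∃ P ∈ supportedStrings S, ∃ c : ℂ, c * c = 1 ∧ M = c • pauliString P := by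
  simp only [SupportedOn, mem_supportedStrings]
  refine exists_congr fun P => and_congr_right fun _ => ⟨?_, ?_⟩
  · rintro (rfl | rfl)
    exacts [⟨1, by simp⟩, ⟨-1, by simp⟩]
  · rintro ⟨c, hc, rfl⟩
    rcases mul_self_eq_one_iff.1 hc with rfl | rfl <;> simp

theorem supportedOn_smul_pauliString_iff {S : Finset ι} {P : ι → Pauli} {c : ℂ}
    (hc : c * c = 1) : SupportedOn S (c • pauliString P) ↔ P ∈ supportedStrings S := by
  refine ⟨fun h => ?_, fun hP => supportedOn_iff.2 ⟨P, hP, c, hc, rfl⟩⟩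
  obtain ⟨Q, hQ, d, -, h⟩ := supportedOn_iff.1 h
  exact eq_of_smul_pauliString_eq (left_ne_zero_of_mul_eq_one hc) h ▸ hQ

theorem IsHermitianPauli.mul_self {M : Op ι} (hM : IsHermitianPauli M) : M * M = 1 := by
  obtain ⟨P, rfl | rfl⟩ := hM <;> simp [pauliString_mul_self]

theorem SupportedOn.smul_mul {S : Finset ι} {M N : Op ι} (hM : SupportedOn S M)
    (hN : SupportedOn S N) {c : ℂ} (sq : c • (M * N) * (c • (M * N)) = 1) :
    SupportedOn S (c • (M * N)) := by
  obtain ⟨P, hP, a, -, rfl⟩ := supportedOn_iff.1 hM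
  obtain ⟨Q, hQ, b, -, rfl⟩ := supportedOn_iff.1 hN
  rw [smul_mul_smul_comm a, pauliString_mul, smul_smul, smul_smul] at sq ⊢
  rw [smul_mul_smul_comm, pauliString_mul_self] at sq
  rw [supportedOn_smul_pauliString_iff (smul_left_injective ℂ one_ne_zero (sq.trans
    (one_smul ℂ _).symm)), mem_supportedStrings]
  intro i hi
  rw [mem_supportedStrings.1 hP i hi, mem_supportedStrings.1 hQ i hi]
  rfl

theorem SupportedOn.mul {S : Finset ι} {M N : Op ι} (hM : SupportedOn S M)
    (hN : SupportedOn S N) (comm : M * N = N * M) : SupportedOn S (M * N) := by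
  have sq : M * N * (M * N) = 1 := by
    rw [Commute.mul_mul_mul_comm comm.symm, hM.isHermitianPauli.mul_self,
      hN.isHermitianPauli.mul_self, one_mul]
  simpa only [one_smul] using hM.smul_mul hN (c := 1) (by simpa only [one_smul] using sq)

theorem IsHermitianPauli.mul {M N : Op ι} (hM : IsHermitianPauli M) (hN : IsHermitianPauli N)
    (comm : M * N = N * M) : IsHermitianPauli (M * N) :=
  ((supportedOn_univ_iff.2 hM).mul (supportedOn_univ_iff.2 hN) comm).isHermitianPauli

theorem SupportedOn.mul_iff {S : Finset ι} {M N : Op ι} (hM : SupportedOn S M)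
    (comm : M * N = N * M) : SupportedOn S (M * N) ↔ SupportedOn S N := by
  have cancel : M * (M * N) = N := by rw [← mul_assoc, hM.isHermitianPauli.mul_self, one_mul]
  refine ⟨fun h => ?_, fun hN => hM.mul hN comm⟩
  rw [← cancel]
  exact hM.mul h (by rw [mul_assoc, ← comm])

theorem IsHermitianPauli.mul_ne_of_anticomm {M N : Op ι} (hM : IsHermitianPauli M)
    (hN : IsHermitianPauli N) (anti : M * N = -(N * M)) : M * N ≠ N * M := by
  intro comm
  rw [← comm, self_eq_neg] at anti
  apply left_ne_zero_of_mul_eq_one hN.mul_self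
  rw [← one_mul N, ← hM.mul_self, mul_assoc, anti, mul_zero]

theorem SupportedOn.mul_comm_of_compl {S : Finset ι} {M N : Op ι} (hM : SupportedOn S M)
    (hN : SupportedOn Sᶜ N) : M * N = N * M := by
  obtain ⟨P, hP, a, -, rfl⟩ := supportedOn_iff.1 hM
  obtain ⟨Q, hQ, b, -, rfl⟩ := supportedOn_iff.1 hN
  have mat_comm (i : ι) : (P i).mat * (Q i).mat = (Q i).mat * (P i).mat := by
    by_cases hi : i ∈ S
    · rw [mem_supportedStrings.1 hQ i (by simpa using hi), Pauli.mat, mul_one, one_mul]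
    · rw [mem_supportedStrings.1 hP i hi, Pauli.mat, mul_one, one_mul]
  have string_comm : pauliString P * pauliString Q = pauliString Q * pauliString P :=
    (tensorProd_mul _ _).trans <|
      (congrArg tensorProd (funext mat_comm)).trans (tensorProd_mul _ _).symm
  rw [smul_mul_smul_comm, smul_mul_smul_comm, string_comm, mul_comm a]

theorem SupportedOn.eq_one_or_eq_neg_one {S : Finset ι} {M : Op ι} (hM : SupportedOn S M)
    (hM' : SupportedOn Sᶜ M) : M = 1 ∨ M = -1 := by
  obtain ⟨P, hP, hM⟩ := hM
  have : P ∈ supportedStrings Sᶜ := by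
    rcases hM with rfl | rfl
    · rwa [← one_smul ℂ (pauliString P), supportedOn_smul_pauliString_iff (one_mul 1)] at hM'
    · rwa [← neg_one_smul ℂ (pauliString P), supportedOn_smul_pauliString_iff (by simp)] at hM'
  obtain rfl : P = fun _ => Pauli.I := funext fun i => by
    by_cases hi : i ∈ S
    · exact mem_supportedStrings.1 this i (by simpa using hi)
    · exact hP i hi
  simpa only [pauliString_I] using hM

end Pauli

section Codes

variable {ι : Type*} [Fintype ι] [DecidableEq ι]

/-- `G` is a stabilizer group: its elements are commuting Hermitian Pauli operators, and `-1` is not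
among them. As in `stabGroup`, inverses are automatic because the elements are involutions. -/
structure IsStabilizerGroup (G : Submonoid (Op ι)) : Prop where
  pauli : ∀ s ∈ G, IsHermitianPauli s
  comm : ∀ s ∈ G, ∀ t ∈ G, s * t = t * s
  neg_one_notMem : (-1 : Op ι) ∉ G

namespace IsStabilizerGenerators

variable {κ : Type*} {g : κ → Op ι}

theorem isIndepInvolutions (hg : IsStabilizerGenerators g) : IsIndepInvolutions g :=
  ⟨hg.comm, fun k => (hg.pauli k).mul_self, hg.independent⟩

theorem isStabilizerGroup (hg : IsStabilizerGenerators g) : IsStabilizerGroup (stabGroup g) := by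
  have comm : ∀ s ∈ stabGroup g, ∀ t ∈ stabGroup g, s * t = t * s := fun s hs t ht =>
    mul_comm_of_mem_closure (by rintro _ ⟨k, rfl⟩ _ ⟨l, rfl⟩; exact hg.comm k l) hs ht
  refine ⟨fun s hs => ?_, comm, hg.neg_one_notMem⟩
  induction hs using Submonoid.closure_induction with
  | mem s hs =>
    obtain ⟨k, rfl⟩ := hs
    exact hg.pauli k
  | one => exact (supportedOn_one ∅).isHermitianPauli
  | mul s t hs ht pauli_s pauli_t => exact pauli_s.mul pauli_t (comm s hs t ht)

theorem not_generatorReducible (hg : IsStabilizerGenerators g) {S : Finset ι} {k : κ}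
    (hS : ∀ s ∈ stabGroup g, SupportedOn S s → s ∈ stabGroupExcept g k) :
    ¬ GeneratorReducible g S k := by
  rintro ⟨s, hs, supp⟩
  have hs' : s ∈ stabGroup g := Submonoid.closure_mono (Set.image_subset_range _ _) hs
  have gks := hS _ (mul_mem (Submonoid.subset_closure ⟨k, rfl⟩) hs') supp
  apply hg.independent k
  rw [← mul_one (g k), ← (hg.isStabilizerGroup.pauli s hs').mul_self, ← mul_assoc]
  exact mul_mem gks hs

end IsStabilizerGenerators

theorem stabGroup_comp_le_stabGroupExcept {κ κ' : Type*} (g : κ → Op ι) {e : κ' → κ} {k : κ}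
    (hk : ∀ j, e j ≠ k) : stabGroup (fun j => g (e j)) ≤ stabGroupExcept g k :=
  Submonoid.closure_mono <| by rintro _ ⟨j, rfl⟩; exact ⟨e j, hk j, rfl⟩

namespace IsStabilizerGroup

variable {G : Submonoid (Op ι)}

theorem finite (hG : IsStabilizerGroup G) : Finite G :=
  finite_setOf_isHermitianPauli.subset hG.pauli

theorem mul_self (hG : IsStabilizerGroup G) {s : Op ι} (hs : s ∈ G) : s * s = 1 :=
  (hG.pauli s hs).mul_self

/-- The subgroup of the stabilizers that are supported on `S`. -/
def supported (hG : IsStabilizerGroup G) (S : Finset ι) : Submonoid (Op ι) where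
  carrier := {s | s ∈ G ∧ SupportedOn S s}
  one_mem' := ⟨one_mem G, supportedOn_one S⟩
  mul_mem' hs ht := ⟨mul_mem hs.1 ht.1, hs.2.mul ht.2 (hG.comm _ hs.1 _ ht.1)⟩

theorem supported_le (hG : IsStabilizerGroup G) (S : Finset ι) : hG.supported S ≤ G :=
  fun _ hs => hs.1

theorem finite_supported (hG : IsStabilizerGroup G) (S : Finset ι) : Finite (hG.supported S) :=
  finite_setOf_isHermitianPauli.subset fun s hs => hG.pauli s hs.1

theorem exists_natCard_supported (hG : IsStabilizerGroup G) (S : Finset ι) :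
    ∃ n, Nat.card (hG.supported S) = 2 ^ n :=
  have := hG.finite_supported S
  exists_natCard_eq_two_pow _ (fun s hs t ht => hG.comm s hs.1 t ht.1)
    fun _ hs => hG.mul_self hs.1

theorem eq_one_of_mem_supported_compl (hG : IsStabilizerGroup G) {S : Finset ι} {s : Op ι}
    (hs : s ∈ hG.supported S) (hs' : s ∈ hG.supported Sᶜ) : s = 1 :=
  (hs.2.eq_one_or_eq_neg_one hs'.2).resolve_right fun h => hG.neg_one_notMem (h ▸ hs.1)

end IsStabilizerGroup

/-- `a`, `b` and `h` form a family of independent generators of the stabilizer group `G` adapted to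
the bipartition into `A` and its complement: `a` generates the stabilizers supported on `A`, and `b`
those supported on the complement. -/
structure IsBipartiteGenerators {κA κB κ : Type*} {G : Submonoid (Op ι)} (hG : IsStabilizerGroup G)
    (A : Finset ι) (a : κA → Op ι) (b : κB → Op ι) (h : κ → Op ι) : Prop where
  isStabilizerGenerators : IsStabilizerGenerators (Sum.elim a (Sum.elim b h))
  stabGroup_eq : stabGroup (Sum.elim a (Sum.elim b h)) = G
  stabGroup_left : stabGroup a = hG.supported A
  stabGroup_right : stabGroup b = hG.supported Aᶜ

theorem IsStabilizerGenerators.exists_isBipartiteGenerators {κ : Type*} [Fintype κ] {g : κ → Op ι}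
    (hg : IsStabilizerGenerators g) (A : Finset ι) :
    ∃ (nA nB m : ℕ) (a : Fin nA → Op ι) (b : Fin nB → Op ι) (h : Fin m → Op ι),
      Fintype.card κ = nA + nB + m ∧ IsBipartiteGenerators hg.isStabilizerGroup A a b h := by
  have hG := hg.isStabilizerGroup
  obtain ⟨nA, nB, m, a, b, h, card, indep, closure_eq, closure_a, closure_b⟩ :=
    hg.isIndepInvolutions.exists_adapted (hG.supported_le A) (hG.supported_le Aᶜ)
      fun _ hs hs' => hG.eq_one_of_mem_supported_compl hs hs'
  have mem (k) : Sum.elim a (Sum.elim b h) k ∈ stabGroup g :=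
    closure_eq.le (Submonoid.subset_closure ⟨k, rfl⟩)
  exact ⟨nA, nB, m, a, b, h, card, ⟨fun k => hG.pauli _ (mem k), indep.comm, indep.independent,
    fun h => hG.neg_one_notMem (closure_eq.le h)⟩, closure_eq, closure_a, closure_b⟩

namespace IsBipartiteGenerators

variable {κA κB κ : Type*} {G : Submonoid (Op ι)} {hG : IsStabilizerGroup G} {A : Finset ι}
  {a : κA → Op ι} {b : κB → Op ι} {h : κ → Op ι}

theorem supportedOn_left (H : IsBipartiteGenerators hG A a b h) (i : κA) : SupportedOn A (a i) :=
  (H.stabGroup_left.le (Submonoid.subset_closure ⟨i, rfl⟩)).2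

theorem supportedOn_right (H : IsBipartiteGenerators hG A a b h) (j : κB) :
    SupportedOn Aᶜ (b j) :=
  (H.stabGroup_right.le (Submonoid.subset_closure ⟨j, rfl⟩)).2

theorem not_generatorReducible_left (H : IsBipartiteGenerators hG A a b h) {k : κA ⊕ κB ⊕ κ}
    (hk : ∀ i, Sum.inl i ≠ k) : ¬ GeneratorReducible (Sum.elim a (Sum.elim b h)) A k :=
  H.isStabilizerGenerators.not_generatorReducible fun _ hs supp =>
    stabGroup_comp_le_stabGroupExcept _ hk (H.stabGroup_left.ge ⟨H.stabGroup_eq.le hs, supp⟩)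

theorem not_generatorReducible_right (H : IsBipartiteGenerators hG A a b h) {k : κA ⊕ κB ⊕ κ}
    (hk : ∀ j, Sum.inr (Sum.inl j) ≠ k) :
    ¬ GeneratorReducible (Sum.elim a (Sum.elim b h)) Aᶜ k :=
  H.isStabilizerGenerators.not_generatorReducible fun _ hs supp =>
    stabGroup_comp_le_stabGroupExcept _ hk (H.stabGroup_right.ge ⟨H.stabGroup_eq.le hs, supp⟩)

end IsBipartiteGenerators

end Codes

section Gauge

variable {ι : Type*} [Fintype ι] [DecidableEq ι] {G : Submonoid (Op ι)}

/-- `σ` is a logical operator of the code with stabilizer group `G`: a Hermitian Pauli operator that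
commutes with every stabilizer. -/
structure IsLogical (G : Submonoid (Op ι)) (σ : Op ι) : Prop where
  pauli : IsHermitianPauli σ
  comm : ∀ s ∈ G, σ * s = s * σ

namespace IsLogical

variable {σ τ s t : Op ι}

theorem mul_stabilizer (hG : IsStabilizerGroup G) (hσ : IsLogical G σ) (hs : s ∈ G) :
    IsLogical G (σ * s) where
  pauli := hσ.pauli.mul (hG.pauli s hs) (hσ.comm s hs)
  comm t ht := by rw [mul_assoc, hG.comm s hs t ht, ← mul_assoc, hσ.comm t ht, mul_assoc]

theorem mul_mul_mul_comm (hτ : IsLogical G τ) (hs : s ∈ G) :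
    σ * s * (τ * t) = σ * τ * (s * t) :=
  Commute.mul_mul_mul_comm (hτ.comm s hs).symm σ t

theorem not_reducible_compl (hG : IsStabilizerGroup G) (hσ : IsLogical G σ) (hτ : IsLogical G τ)
    (anti : σ * τ = -(τ * σ)) {S : Finset ι} (red : LogicalReducible G S σ) :
    ¬ LogicalReducible G Sᶜ τ := by
  obtain ⟨s, hs, supp⟩ := red
  rintro ⟨t, ht, supp'⟩
  have anti' : σ * s * (τ * t) = -(τ * t * (σ * s)) := by
    rw [hτ.mul_mul_mul_comm hs, hσ.mul_mul_mul_comm ht, anti, hG.comm s hs t ht, neg_mul]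
  exact supp.isHermitianPauli.mul_ne_of_anticomm supp'.isHermitianPauli anti'
    (supp.mul_comm_of_compl supp')

end IsLogical

theorem exists_supportedOn_of_logicalReducible (G : Submonoid (Op ι)) (S : Finset ι) (σ : Op ι) :
    ∃ s ∈ G, LogicalReducible G S σ → SupportedOn S (σ * s) := by
  by_cases red : LogicalReducible G S σ
  · obtain ⟨s, hs, supp⟩ := red
    exact ⟨s, hs, fun _ => supp⟩
  · exact ⟨1, one_mem G, fun h => absurd h red⟩

theorem exists_gauge_side (hG : IsStabilizerGroup G) {P : Set (Op ι)}
    (hP : ∀ σ ∈ P, IsLogical G σ) (anti : P.Pairwise fun σ τ => σ * τ = -(τ * σ))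
    (A : Finset ι) :
    ∃ T, ∀ σ ∈ P, (LogicalReducible G A σ → T = A) ∧
      (¬ LogicalReducible G A σ → LogicalReducible G Aᶜ σ → T = Aᶜ) := by
  by_cases hA : ∃ τ ∈ P, LogicalReducible G A τ
  · obtain ⟨τ, hτ, red⟩ := hA
    refine ⟨A, fun σ hσ => ⟨fun _ => rfl, fun not_red red' => absurd red' ?_⟩⟩
    have ne : τ ≠ σ := fun h => not_red (h ▸ red)
    exact (hP τ hτ).not_reducible_compl hG (hP σ hσ) (anti hτ hσ ne) red
  · exact ⟨Aᶜ, fun σ hσ => ⟨fun red => absurd ⟨σ, hσ, red⟩ hA, fun _ _ => rfl⟩⟩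

namespace IsLogicalTriple

variable {X Y Z : Op ι}

theorem isLogical_X (h : IsLogicalTriple G X Y Z) : IsLogical G X := ⟨h.pauli_X, h.comm_X⟩

theorem isLogical_Y (h : IsLogicalTriple G X Y Z) : IsLogical G Y := ⟨h.pauli_Y, h.comm_Y⟩

theorem isLogical_Z (h : IsLogicalTriple G X Y Z) : IsLogical G Z := ⟨h.pauli_Z, h.comm_Z⟩

theorem X_mul_Y (h : IsLogicalTriple G X Y Z) : X * Y = Complex.I • Z := by
  rw [h.Y_eq, Matrix.mul_smul, ← mul_assoc, h.pauli_X.mul_self, one_mul]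

theorem Y_mul_Z (h : IsLogicalTriple G X Y Z) : Y * Z = Complex.I • X := by
  rw [h.Y_eq, Matrix.smul_mul, mul_assoc, h.pauli_Z.mul_self, mul_one]

theorem Y_mul_X (h : IsLogicalTriple G X Y Z) : Y * X = -(X * Y) := by
  rw [h.X_mul_Y, h.Y_eq, Matrix.smul_mul, mul_assoc, ← neg_eq_iff_eq_neg.2 h.anticomm, mul_neg,
    ← mul_assoc, h.pauli_X.mul_self, one_mul, smul_neg]

theorem Z_mul_Y (h : IsLogicalTriple G X Y Z) : Z * Y = -(Y * Z) := by
  rw [h.Y_mul_Z, h.Y_eq, Matrix.mul_smul, ← mul_assoc, ← neg_eq_iff_eq_neg.2 h.anticomm, neg_mul,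
    mul_assoc, h.pauli_Z.mul_self, mul_one, smul_neg]

theorem pairwise_anticomm (h : IsLogicalTriple G X Y Z) :
    ({X, Y, Z} : Set (Op ι)).Pairwise fun σ τ => σ * τ = -(τ * σ) := by
  have symm : Std.Symm fun σ τ : Op ι => σ * τ = -(τ * σ) :=
    ⟨fun _ _ anti => (neg_eq_iff_eq_neg.2 anti).symm⟩
  rw [Set.pairwise_insert_of_symm, Set.pairwise_pair_of_symm]
  refine ⟨fun _ => symm.symm _ _ h.Z_mul_Y, ?_⟩
  rintro σ (rfl | rfl) -
  exacts [symm.symm _ _ h.Y_mul_X, h.anticomm]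

theorem mul_stabilizers (hG : IsStabilizerGroup G) (h : IsLogicalTriple G X Y Z) {s t : Op ι}
    (hs : s ∈ G) (ht : t ∈ G) : IsLogicalTriple G (X * s) (Y * (s * t)) (Z * t) where
  pauli_X := (h.isLogical_X.mul_stabilizer hG hs).pauli
  pauli_Y := (h.isLogical_Y.mul_stabilizer hG (mul_mem hs ht)).pauli
  pauli_Z := (h.isLogical_Z.mul_stabilizer hG ht).pauli
  comm_X := (h.isLogical_X.mul_stabilizer hG hs).comm
  comm_Y := (h.isLogical_Y.mul_stabilizer hG (mul_mem hs ht)).comm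
  comm_Z := (h.isLogical_Z.mul_stabilizer hG ht).comm
  anticomm := by
    rw [h.isLogical_Z.mul_mul_mul_comm hs, h.isLogical_X.mul_mul_mul_comm ht, h.anticomm,
      hG.comm s hs t ht, neg_mul]
  Y_eq := by rw [h.isLogical_Z.mul_mul_mul_comm hs, h.Y_eq, Matrix.smul_mul]

theorem exists_supported_representatives (hG : IsStabilizerGroup G) (h : IsLogicalTriple G X Y Z)
    (S : Finset ι) :
    ∃ s ∈ G, ∃ t ∈ G, (LogicalReducible G S X → SupportedOn S (X * s)) ∧
      (LogicalReducible G S Y → SupportedOn S (Y * (s * t))) ∧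
      (LogicalReducible G S Z → SupportedOn S (Z * t)) := by
  obtain ⟨s, hs, supp_X⟩ := exists_supportedOn_of_logicalReducible G S X
  obtain ⟨u, hu, supp_Y⟩ := exists_supportedOn_of_logicalReducible G S Y
  obtain ⟨t, ht, supp_Z⟩ := exists_supportedOn_of_logicalReducible G S Z
  by_cases red_Z : LogicalReducible G S Z
  · by_cases red_X : LogicalReducible G S X
    · have h' := h.mul_stabilizers hG hs ht
      refine ⟨s, hs, t, ht, supp_X, fun _ => ?_, supp_Z⟩
      rw [h'.Y_eq]
      exact (supp_X red_X).smul_mul (supp_Z red_Z) (h'.Y_eq ▸ h'.pauli_Y.mul_self)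
    · refine ⟨u * t, mul_mem hu ht, t, ht, fun red => absurd red red_X, ?_, supp_Z⟩
      rwa [mul_assoc u, hG.mul_self ht, mul_one]
  · refine ⟨s, hs, s * u, mul_mem hs hu, supp_X, ?_, fun red => absurd red red_Z⟩
    rwa [← mul_assoc s, hG.mul_self hs, one_mul]

theorem exists_gauge_representatives (hG : IsStabilizerGroup G) (h : IsLogicalTriple G X Y Z)
    (A : Finset ι) :
    ∃ s ∈ G, ∃ t ∈ G, IsGaugeRepresentative G A X (X * s) ∧
      IsGaugeRepresentative G A Y (Y * (s * t)) ∧ IsGaugeRepresentative G A Z (Z * t) := by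
  have logical : ∀ σ ∈ ({X, Y, Z} : Set (Op ι)), IsLogical G σ := by
    rintro σ (rfl | rfl | rfl)
    exacts [h.isLogical_X, h.isLogical_Y, h.isLogical_Z]
  obtain ⟨T, hT⟩ := exists_gauge_side hG logical h.pairwise_anticomm A
  have gauge {σ s : Op ι} (hσ : σ ∈ ({X, Y, Z} : Set (Op ι))) (hs : s ∈ G)
      (supp : LogicalReducible G T σ → SupportedOn T (σ * s)) :
      IsGaugeRepresentative G A σ (σ * s) := by
    refine ⟨⟨s, hs, rfl⟩, fun red => ?_, fun not_red red => ?_⟩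
    · obtain rfl := (hT σ hσ).1 red
      exact supp red
    · obtain rfl := (hT σ hσ).2 not_red red
      exact supp red
  obtain ⟨s, hs, t, ht, supp_X, supp_Y, supp_Z⟩ := h.exists_supported_representatives hG T
  exact ⟨s, hs, t, ht, gauge (by simp) hs supp_X, gauge (by simp) (mul_mem hs ht) supp_Y,
    gauge (by simp) ht supp_Z⟩

end IsLogicalTriple

end Gauge

section Spectrum

variable {ι : Type*} [Fintype ι] [DecidableEq ι]

theorem sum_apply_sum_ite {κ α R E : Type*} [Fintype κ] [DecidableEq α] [AddCommMonoid R]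
    [AddCommMonoid E] {P : κ → α} (hP : Function.Injective P) (c : κ → R) (S : Finset α)
    {f : R → E} (zero : f 0 = 0) :
    ∑ Q ∈ S, f (∑ k, if P k = Q then c k else 0) = ∑ k, if P k ∈ S then f (c k) else 0 := by
  classical
  have apply_sum (Q : α) :
      f (∑ k, if P k = Q then c k else 0) = ∑ k, if P k = Q then f (c k) else 0 := by
    by_cases hQ : ∃ k, P k = Q
    · obtain ⟨k, rfl⟩ := hQ
      simp only [hP.eq_iff, Finset.sum_ite_eq', Finset.mem_univ, if_true]
    · have ne (k : κ) : P k ≠ Q := fun h => hQ ⟨k, h⟩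
      simp only [ne, if_false, Finset.sum_const_zero, zero]
  simp only [apply_sum]
  rw [Finset.sum_comm]
  simp only [Finset.sum_ite_eq]

theorem trace_pauliString_mul_sum {κ : Type*} [Fintype κ] (P : κ → ι → Pauli) (c : κ → ℂ)
    (Q : ι → Pauli) :
    (pauliString Q * (1 / 2 ^ Fintype.card ι : ℂ) • ∑ k, c k • pauliString (P k)).trace =
      ∑ k, if P k = Q then c k else 0 := by
  rw [Matrix.mul_smul, Matrix.trace_smul, Finset.mul_sum, Matrix.trace_sum, Finset.smul_sum]
  refine Finset.sum_congr rfl fun k _ => ?_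
  rw [Matrix.mul_smul, Matrix.trace_smul, trace_pauliString_mul]
  by_cases hQ : P k = Q
  · rw [if_pos hQ.symm, if_pos hQ, smul_eq_mul, smul_eq_mul]
    field_simp
  · rw [if_neg (Ne.symm hQ), if_neg hQ, smul_zero, smul_zero]

open Classical in
theorem sum_supportedStrings_trace {κ E : Type*} [Fintype κ] [AddCommMonoid E] {U : κ → Op ι}
    (hU : ∀ k, IsHermitianPauli (U k)) (ne : Pairwise fun k l => U k ≠ U l ∧ U k ≠ -U l)
    (c : κ → ℂ) {f : ℂ → E} (zero : f 0 = 0) (even : ∀ z, f (-z) = f z) (S : Finset ι) :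
    ∑ Q ∈ supportedStrings S,
        f (pauliString Q * (1 / 2 ^ Fintype.card ι : ℂ) • ∑ k, c k • U k).trace =
      ∑ k, if SupportedOn S (U k) then f (c k) else 0 := by
  choose P e he hP using fun k => (hU k).exists_smul
  have injective : Function.Injective P := fun k l hkl => by
    by_contra hne
    obtain ⟨ne_pos, ne_neg⟩ := ne hne
    rw [hP k, hP l, hkl] at ne_pos ne_neg
    rcases mul_self_eq_one_iff.1 (he k) with h | h <;>
      rcases mul_self_eq_one_iff.1 (he l) with h' | h' <;> simp [h, h'] at ne_pos ne_neg
  simp only [hP, smul_smul, trace_pauliString_mul_sum, sum_apply_sum_ite injective _ _ zero]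
  refine Finset.sum_congr rfl fun k _ => ?_
  simp only [supportedOn_smul_pauliString_iff (he k)]
  rcases mul_self_eq_one_iff.1 (he k) with h | h <;> simp only [h, mul_one, mul_neg, even]

variable {G : Submonoid (Op ι)}

/-- `σ` and `τ` act in the same way on the code space, up to sign. -/
def LogicalEquiv (G : Submonoid (Op ι)) (σ τ : Op ι) : Prop :=
  ∃ s ∈ G, τ = σ * s ∨ τ = -(σ * s)

namespace LogicalEquiv

variable {σ τ υ : Op ι}

theorem symm (hG : IsStabilizerGroup G) (h : LogicalEquiv G σ τ) : LogicalEquiv G τ σ := by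
  obtain ⟨s, hs, rfl | rfl⟩ := h
  · exact ⟨s, hs, Or.inl (by rw [mul_assoc, hG.mul_self hs, mul_one])⟩
  · exact ⟨s, hs, Or.inr (by rw [neg_mul, neg_neg, mul_assoc, hG.mul_self hs, mul_one])⟩

theorem of_mul (hG : IsStabilizerGroup G) {s t : Op ι} (hs : s ∈ G) (ht : t ∈ G)
    (h : σ * s = τ * t ∨ σ * s = -(τ * t)) : LogicalEquiv G σ τ := by
  have cancel : τ = τ * t * t := by rw [mul_assoc, hG.mul_self ht, mul_one]
  refine ⟨s * t, mul_mem hs ht, h.imp (fun h => ?_) fun h => ?_⟩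
  · rw [← mul_assoc, h, ← cancel]
  · rw [← mul_assoc, h, neg_mul, neg_neg, ← cancel]

theorem mul_comm (h : LogicalEquiv G σ τ) (hυ : IsLogical G υ) (comm : υ * σ = σ * υ) :
    υ * τ = τ * υ := by
  obtain ⟨s, hs, h⟩ := h
  have comm' : υ * (σ * s) = σ * s * υ := by
    rw [← mul_assoc, comm, mul_assoc, hυ.comm s hs, mul_assoc]
  rcases h with rfl | rfl
  · exact comm'
  · rw [mul_neg, neg_mul, comm']

theorem not_of_anticomm (hυ : IsLogical G υ) (hτ : IsLogical G τ) (comm : υ * σ = σ * υ)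
    (anti : υ * τ = -(τ * υ)) : ¬ LogicalEquiv G σ τ := fun h =>
  hυ.pauli.mul_ne_of_anticomm hτ.pauli anti (h.mul_comm hυ comm)

end LogicalEquiv

theorem IsStabilizerGroup.neg_notMem (hG : IsStabilizerGroup G) {s : Op ι} (hs : s ∈ G) :
    -s ∉ G := by
  intro hs'
  apply hG.neg_one_notMem
  rw [← hG.mul_self hs, ← neg_mul]
  exact mul_mem hs' hs

theorem IsLogical.eq_of_mul (hG : IsStabilizerGroup G) {σ s t : Op ι} (hσ : IsLogical G σ)
    (hs : s ∈ G) (ht : t ∈ G) (h : σ * s = σ * t ∨ σ * s = -(σ * t)) : s = t := by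
  have cancel (x : Op ι) : σ * (σ * x) = x := by rw [← mul_assoc, hσ.pauli.mul_self, one_mul]
  rcases h with h | h
  · rw [← cancel s, h, cancel]
  · have eq_neg : s = -t := by rw [← cancel s, h, mul_neg, cancel]
    exact absurd (eq_neg ▸ hs) (hG.neg_notMem ht)

open Classical in
theorem IsStabilizerGroup.sum_ite_supportedOn [Fintype G] {E : Type*} [AddCommMonoid E]
    (hG : IsStabilizerGroup G) (S : Finset ι) (r : E) :
    (∑ s : G, if SupportedOn S (s : Op ι) then r else 0) = Nat.card (hG.supported S) • r := by
  rw [← Finset.sum_filter, Finset.sum_const, ← Fintype.card_subtype, ← Nat.card_eq_fintype_card]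
  exact congrArg (· • r) (Nat.card_congr
    (Equiv.subtypeSubtypeEquivSubtypeInter (· ∈ G) fun s => SupportedOn S s))

open Classical in
theorem IsLogical.sum_ite_supportedOn_mul [Fintype G] {E : Type*} [AddCommMonoid E]
    (hG : IsStabilizerGroup G) {σ : Op ι} (hσ : IsLogical G σ) (S : Finset ι) (r : E) :
    (∑ s : G, if SupportedOn S (σ * s) then r else 0) =
      Nat.card (hG.supported S) • if LogicalReducible G S σ then r else 0 := by
  by_cases red : LogicalReducible G S σ
  · rw [if_pos red, ← hG.sum_ite_supportedOn]
    obtain ⟨t, ht, supp⟩ := red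
    have involutive : Function.Involutive fun s : G => ⟨t, ht⟩ * s := fun s =>
      Subtype.ext <| by simp only [Submonoid.coe_mul, ← mul_assoc, hG.mul_self ht, one_mul]
    rw [← Equiv.sum_comp involutive.toPerm]
    refine Finset.sum_congr rfl fun s _ => if_congr ?_ rfl rfl
    change SupportedOn S (σ * (t * s)) ↔ _
    rw [← mul_assoc]
    exact supp.mul_iff ((hσ.mul_stabilizer hG ht).comm s s.2)
  · rw [if_neg red, smul_zero]
    exact Finset.sum_eq_zero fun s _ => if_neg fun supp => red ⟨s, s.2, supp⟩

open Classical in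
theorem IsStabilizerGroup.sum_supportedStrings_trace (hG : IsStabilizerGroup G) {κ E : Type*}
    [Fintype κ] [AddCommMonoid E] {σ : κ → Op ι} (hσ : ∀ i, IsLogical G (σ i))
    (inequiv : Pairwise fun i j => ¬ LogicalEquiv G (σ i) (σ j)) (c : κ → ℂ) {f : ℂ → E}
    (zero : f 0 = 0) (even : ∀ z, f (-z) = f z) (S : Finset ι) :
    ∑ Q ∈ supportedStrings S, f (pauliString Q *
        (1 / 2 ^ Fintype.card ι : ℂ) • ((∑ i, c i • σ i) * elementSum G)).trace =
      Nat.card (hG.supported S) • ∑ i, if LogicalReducible G S (σ i) then f (c i) else 0 := by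
  have := hG.finite
  let _ := Fintype.ofFinite G
  have expand : (∑ i, c i • σ i) * elementSum G =
      ∑ k : κ × G, c k.1 • (σ k.1 * (k.2 : Op ι)) := by
    simp only [elementSum, finsum_eq_sum_of_fintype, Finset.sum_mul_sum, Fintype.sum_prod_type,
      Matrix.smul_mul]
  have ne : Pairwise fun k l : κ × G =>
      σ k.1 * (k.2 : Op ι) ≠ σ l.1 * l.2 ∧ σ k.1 * (k.2 : Op ι) ≠ -(σ l.1 * l.2) := by
    rintro ⟨i, s⟩ ⟨j, t⟩ hne
    rw [← not_or]
    intro h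
    obtain rfl : i = j := by_contra fun hij => inequiv hij (LogicalEquiv.of_mul hG s.2 t.2 h)
    exact hne (congrArg (i, ·) (Subtype.ext ((hσ i).eq_of_mul hG s.2 t.2 h)))
  rw [expand, MagicGauge.sum_supportedStrings_trace (U := fun k : κ × G => σ k.1 * (k.2 : Op ι))
    (fun k => ((hσ k.1).mul_stabilizer hG k.2.2).pauli) ne (fun k => c k.1) zero even,
    Fintype.sum_prod_type, Finset.smul_sum]
  exact Finset.sum_congr rfl fun i _ => (hσ i).sum_ite_supportedOn_mul hG S (f (c i))

end Spectrum

section PartialTrace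

variable {ι : Type*} [Fintype ι] [DecidableEq ι]

/-- The Pauli string on all qubits that extends a Pauli string on `A` by the identity. -/
def extendString {ι : Type*} [DecidableEq ι] (A : Finset ι) (P : {i // i ∈ A} → Pauli) :
    ι → Pauli :=
  fun i => if h : i ∈ A then P ⟨i, h⟩ else Pauli.I

theorem pauliString_extendString_glue (A : Finset ι) (P : {i // i ∈ A} → Pauli)
    (x y : {i // i ∈ A} → Fin 2) (z w : {i // i ∉ A} → Fin 2) :
    pauliString (extendString A P) (glue A x z) (glue A y w) =
      if z = w then pauliString P x y else 0 := by
  let F (i : ι) : ℂ := (extendString A P i).mat (glue A x z i) (glue A y w i)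
  have mem_factor (i : {i // i ∈ A}) : F i = (P i).mat (x i) (y i) := by
    simp only [F, extendString, glue, i.2, dif_pos]
  have notMem_factor (i : {i // i ∉ A}) : F i = Pauli.I.mat (z i) (w i) := by
    simp only [F, extendString, glue, i.2, dif_neg, not_false_iff]
  calc pauliString (extendString A P) (glue A x z) (glue A y w)
    _ = ∏ i, F i := rfl
    _ = (∏ i : {i // i ∈ A}, F i) * ∏ i : {i // i ∉ A}, F i := by
      convert (Fintype.prod_subtype_mul_prod_subtype (· ∈ A) F).symm
    _ = pauliString P x y * pauliString (fun _ => Pauli.I) z w := by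
      simp only [mem_factor, notMem_factor]
      rfl
    _ = if z = w then pauliString P x y else 0 := by
      rw [pauliString_I, Matrix.one_apply, mul_ite, mul_one, mul_zero]

theorem sum_glue {E : Type*} [AddCommMonoid E] (A : Finset ι) (f : (ι → Fin 2) → E) :
    ∑ x, f x = ∑ x : {i // i ∈ A} → Fin 2, ∑ z : {i // i ∉ A} → Fin 2, f (glue A x z) := by
  rw [← Fintype.sum_prod_type']
  exact ((Equiv.piEquivPiSubtypeProd (· ∈ A) fun _ => Fin 2).symm.sum_comp f).symm

theorem trace_pauliString_mul_reducedState (A : Finset ι) (P : {i // i ∈ A} → Pauli) (ρ : Op ι) :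
    (pauliString P * reducedState A ρ).trace = (pauliString (extendString A P) * ρ).trace := by
  simp only [Matrix.trace, Matrix.diag_apply, Matrix.mul_apply]
  rw [sum_glue A]
  refine Finset.sum_congr rfl fun x _ => ?_
  simp only [sum_glue A (fun y => pauliString (extendString A P) _ y * ρ y _),
    pauliString_extendString_glue, ite_mul, zero_mul, Finset.sum_ite_eq, Finset.mem_univ, if_true,
    reducedState, Matrix.of_apply, Finset.mul_sum]
  exact Finset.sum_comm

theorem sum_extendString {E : Type*} [AddCommMonoid E] (A : Finset ι) (f : (ι → Pauli) → E) :
    ∑ P, f (extendString A P) = ∑ Q ∈ supportedStrings A, f Q := by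
  refine Finset.sum_bij' (fun P _ => extendString A P) (fun Q _ i => Q i) (fun P _ => ?_)
    (fun _ _ => Finset.mem_univ _) (fun P _ => ?_) (fun Q hQ => ?_) fun _ _ => rfl
  · exact mem_supportedStrings.2 fun i hi => dif_neg hi
  · exact funext fun i => dif_pos i.2
  · funext i
    by_cases hi : i ∈ A
    · exact dif_pos hi
    · exact (dif_neg hi).trans (mem_supportedStrings.1 hQ i hi).symm

end PartialTrace

section Purity

variable {ι : Type*} [Fintype ι] [DecidableEq ι]

theorem sum_supportedStrings_mul (S : Finset ι) (x y z w : ι → Fin 2) :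
    ∑ Q ∈ supportedStrings S, pauliString Q x y * pauliString Q z w =
      ∏ i, if i ∈ S then (if x i = w i ∧ y i = z i then 2 else 0)
        else if x i = y i ∧ z i = w i then (1 : ℂ) else 0 := by
  simp only [pauliString, Matrix.of_apply, ← Finset.prod_mul_distrib]
  rw [supportedStrings,
    ← Finset.prod_univ_sum _ fun i p => Pauli.mat p (x i) (y i) * p.mat (z i) (w i)]
  refine Finset.prod_congr rfl fun i _ => ?_
  by_cases hi : i ∈ S
  · rw [if_pos hi, if_pos hi, Pauli.sum_mat_mul_mat]
  · simp only [if_neg hi, Finset.sum_singleton, Pauli.mat, Matrix.one_apply, ite_and, ite_mul,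
      one_mul, zero_mul]

theorem sum_supportedStrings_compl_mul (S : Finset ι) (x y z w : ι → Fin 2) :
    2 ^ Sᶜ.card * ∑ Q ∈ supportedStrings S, pauliString Q x y * pauliString Q z w =
      2 ^ S.card * ∑ Q ∈ supportedStrings Sᶜ, pauliString Q x w * pauliString Q z y := by
  have two_pow_card (T : Finset ι) : (2 : ℂ) ^ T.card = ∏ i, if i ∈ T then 2 else 1 := by simp
  rw [sum_supportedStrings_mul, sum_supportedStrings_mul, two_pow_card, two_pow_card,
    ← Finset.prod_mul_distrib, ← Finset.prod_mul_distrib]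
  refine Finset.prod_congr rfl fun i _ => ?_
  by_cases hi : i ∈ S <;> simp [hi, eq_comm]

theorem trace_mul_vecMulVec_sq {n R : Type*} [Fintype n] [CommSemiring R] (M : Matrix n n R)
    (u v : n → R) :
    (M * Matrix.vecMulVec u v).trace ^ 2 =
      ∑ p : n × n, ∑ q : n × n, M p.1 q.1 * M p.2 q.2 * (u q.1 * v p.1 * (u q.2 * v p.2)) := by
  simp only [Matrix.trace, Matrix.diag_apply, Matrix.mul_apply, Matrix.vecMulVec_apply, sq,
    Finset.sum_mul_sum, Fintype.sum_prod_type, mul_mul_mul_comm]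

-- Exchanging the two column indices turns the strings on `S` into those on the complement and
-- fixes the coefficients of a rank-one operator: the complementary reductions of a pure state have
-- the same purity.
theorem sum_supportedStrings_compl_trace_sq (S : Finset ι) (u v : (ι → Fin 2) → ℂ) :
    2 ^ Sᶜ.card * ∑ Q ∈ supportedStrings S, (pauliString Q * Matrix.vecMulVec u v).trace ^ 2 =
      2 ^ S.card *
        ∑ Q ∈ supportedStrings Sᶜ, (pauliString Q * Matrix.vecMulVec u v).trace ^ 2 := by
  have expand (T : Finset ι) :
      ∑ Q ∈ supportedStrings T, (pauliString Q * Matrix.vecMulVec u v).trace ^ 2 =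
        ∑ p : (ι → Fin 2) × (ι → Fin 2), ∑ q : (ι → Fin 2) × (ι → Fin 2),
          (∑ Q ∈ supportedStrings T, pauliString Q p.1 q.1 * pauliString Q p.2 q.2) *
            (u q.1 * v p.1 * (u q.2 * v p.2)) := by
    simp only [trace_mul_vecMulVec_sq, Finset.sum_mul]
    rw [Finset.sum_comm]
    exact Finset.sum_congr rfl fun p _ => Finset.sum_comm
  rw [expand, expand, Finset.mul_sum, Finset.mul_sum]
  refine Finset.sum_congr rfl fun p _ => ?_
  rw [← (Equiv.prodComm (ι → Fin 2) (ι → Fin 2)).sum_comp, Finset.mul_sum, Finset.mul_sum]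
  refine Finset.sum_congr rfl fun q _ => ?_
  simp only [Equiv.prodComm_apply, Prod.fst_swap, Prod.snd_swap]
  rw [← mul_assoc, ← mul_assoc, sum_supportedStrings_compl_mul]
  ring

end Purity

section MagicState

variable {ι : Type*} [Fintype ι] [DecidableEq ι] {G : Submonoid (Op ι)} {X Y Z : Op ι}

/-- The density matrix of the magic state encoded in the code with stabilizer group `G`, whose
expectation values of the logical operators `Z` and `Y` are `1 / √2` and `-1 / √2`. -/
def magicState (G : Submonoid (Op ι)) (Y Z : Op ι) : Op ι :=
  (1 / 2 ^ Fintype.card ι : ℂ) • ((1 + ((1 / √2 : ℝ) : ℂ) • (Z - Y)) * elementSum G)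

theorem magicState_stabGroup {n : ℕ} {g : Fin n → Op ι} (hg : IsIndepInvolutions g) :
    magicState (stabGroup g) Y Z = ((1 / 2 ^ Fintype.card ι : ℝ) : ℂ) •
      ((1 + ((1 / √2 : ℝ) : ℂ) • (Z - Y)) * (List.ofFn fun j => 1 + g j).prod) := by
  rw [hg.prod_ofFn_one_add, magicState, stabGroup]
  push_cast
  rfl

theorem magicState_mul (hG : IsStabilizerGroup G) {s t : Op ι} (hs : s ∈ G) (ht : t ∈ G) :
    magicState G (Y * s) (Z * t) = magicState G Y Z := by
  have := hG.finite
  simp only [magicState, add_mul, Matrix.smul_mul, sub_mul, mul_assoc,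
    mul_elementSum G hs (hG.mul_self hs), mul_elementSum G ht (hG.mul_self ht)]

theorem magicState_eq_mul_prod {p q r : ℕ} {a : Fin p → Op ι} {b : Fin q → Op ι}
    {h : Fin r → Op ι} (hg : IsIndepInvolutions (Sum.elim a (Sum.elim b h)))
    (card : Fintype.card ι = p + q + r + 1) :
    magicState (stabGroup (Sum.elim a (Sum.elim b h))) Y Z =
      ((1 / 2 : ℂ) • (1 : Op ι) + ((1 / (2 * √2) : ℝ) : ℂ) • (Z - Y)) *
        (List.ofFn fun i => (1 / 2 : ℂ) • (1 + a i)).prod *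
        (List.ofFn fun j => (1 / 2 : ℂ) • (1 + b j)).prod *
        (List.ofFn fun k => (1 / 2 : ℂ) • (1 + h k)).prod := by
  have normalization : (1 / 2 : ℂ) • (1 : Op ι) + ((1 / (2 * √2) : ℝ) : ℂ) • (Z - Y) =
      (1 / 2 : ℂ) • (1 + ((1 / √2 : ℝ) : ℂ) • (Z - Y)) := by
    rw [smul_add, smul_smul, one_div_mul_eq_div]
    push_cast
    rw [div_div, mul_comm]
  rw [mul_assoc, mul_assoc, ← mul_assoc (List.ofFn _).prod, hg.prod_ofFn_smul_one_add,
    normalization, smul_mul_smul_comm, ← pow_succ', ← card, one_div_pow]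
  rfl

open Classical in
/-- The number of the logical operators `Z` and `Y` that are reducible to `S`. -/
def reducibleCount (G : Submonoid (Op ι)) (S : Finset ι) (Y Z : Op ι) : ℕ :=
  (if LogicalReducible G S Z then 1 else 0) + if LogicalReducible G S Y then 1 else 0

theorem reducibleCount_le_two (G : Submonoid (Op ι)) (S : Finset ι) (Y Z : Op ι) :
    reducibleCount G S Y Z ≤ 2 := by
  unfold reducibleCount
  split_ifs <;> norm_num

theorem isLogical_one (G : Submonoid (Op ι)) : IsLogical G 1 where
  pauli := (supportedOn_one Finset.univ).isHermitianPauli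
  comm s _ := by rw [one_mul, mul_one]

theorem logicalReducible_one (G : Submonoid (Op ι)) (S : Finset ι) : LogicalReducible G S 1 :=
  ⟨1, one_mem G, by rw [one_mul]; exact supportedOn_one S⟩

namespace IsLogicalTriple

theorem pairwise_not_logicalEquiv (hG : IsStabilizerGroup G) (h : IsLogicalTriple G X Y Z) :
    Pairwise fun i j => ¬ LogicalEquiv G (![1, Z, Y] i) (![1, Z, Y] j) := by
  have anti : Y * Z = -(Z * Y) := (neg_eq_iff_eq_neg.2 h.Z_mul_Y).symm
  have one_Z : ¬ LogicalEquiv G 1 Z :=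
    LogicalEquiv.not_of_anticomm h.isLogical_Y h.isLogical_Z (by simp) anti
  have one_Y : ¬ LogicalEquiv G 1 Y :=
    LogicalEquiv.not_of_anticomm h.isLogical_Z h.isLogical_Y (by simp) h.Z_mul_Y
  have Z_Y : ¬ LogicalEquiv G Z Y :=
    LogicalEquiv.not_of_anticomm h.isLogical_Z h.isLogical_Y rfl h.Z_mul_Y
  intro i j hij equiv
  have equiv' := equiv.symm hG
  fin_cases i <;> fin_cases j
  all_goals first | exact hij rfl | exact one_Z ‹_› | exact one_Y ‹_› | exact Z_Y ‹_›

theorem sum_trace_magicState (hG : IsStabilizerGroup G) (h : IsLogicalTriple G X Y Z)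
    {E : Type*} [AddCommMonoid E] {f : ℂ → E} (zero : f 0 = 0) (even : ∀ z, f (-z) = f z)
    (S : Finset ι) :
    ∑ Q ∈ supportedStrings S, f (pauliString Q * magicState G Y Z).trace =
      Nat.card (hG.supported S) •
        (f 1 + reducibleCount G S Y Z • f ((1 / √2 : ℝ) : ℂ)) := by
  have logical (i) : IsLogical G (![1, Z, Y] i) := by
    fin_cases i
    exacts [isLogical_one G, h.isLogical_Z, h.isLogical_Y]
  have sum_smul (w : ℂ) : ∑ i, ![1, w, -w] i • ![1, Z, Y] i = 1 + w • (Z - Y) := by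
    rw [Fin.sum_univ_three, smul_sub, sub_eq_add_neg, ← neg_smul, ← add_assoc]
    exact congrArg (· + _ + _) (one_smul ℂ 1)
  rw [magicState, ← sum_smul, hG.sum_supportedStrings_trace logical
    (h.pairwise_not_logicalEquiv hG) _ zero even, Fin.sum_univ_three]
  congr 1
  unfold reducibleCount
  split_ifs <;> simp_all [logicalReducible_one, two_nsmul, add_assoc]

end IsLogicalTriple

theorem eq_one_of_two_pow_mul_eq {a b p : ℕ} (h : 2 ^ a * (2 + 1) = 2 ^ b * (2 + p))
    (hp : p ≤ 2) : p = 1 := by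
  have dvd : 3 ∣ 2 + p :=
    (Nat.Coprime.pow_right b (by norm_num : Nat.Coprime 3 2)).dvd_of_dvd_mul_left
      (h ▸ dvd_mul_left 3 (2 ^ a))
  omega

namespace IsLogicalTriple

theorem magic_reducedState (hG : IsStabilizerGroup G) (h : IsLogicalTriple G X Y Z)
    (A : Finset ι) :
    magic (reducedState A (magicState G Y Z)) =
      Real.logb 2 ((4 + 2 * reducibleCount G A Y Z) / (4 + reducibleCount G A Y Z)) := by
  have := hG.finite_supported A
  have card_ne_zero : (Nat.card (hG.supported A) : ℝ) ≠ 0 :=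
    Nat.cast_ne_zero.2 Nat.card_pos.ne'
  have sq_eq : (1 / √2 : ℝ) ^ 2 = 1 / 2 := by
    rw [div_pow, Real.sq_sqrt zero_le_two, one_pow]
  have pow_four_eq : (1 / √2 : ℝ) ^ 4 = 1 / 4 := by
    rw [pow_mul _ 2 2, sq_eq]
    norm_num
  have sum_pow (n : ℕ) (hn : Even n) (hn' : n ≠ 0) :
      ∑ P, (pauliString P * reducedState A (magicState G Y Z)).trace.re ^ n =
        Nat.card (hG.supported A) * (1 + reducibleCount G A Y Z * (1 / √2) ^ n) := by
    simp only [trace_pauliString_mul_reducedState]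
    rw [sum_extendString A fun Q => (pauliString Q * magicState G Y Z).trace.re ^ n,
      h.sum_trace_magicState hG (f := fun z => z.re ^ n) (by simp [hn'])
        fun z => hn.neg_pow z.re]
    simp only [Complex.one_re, one_pow, Complex.ofReal_re, nsmul_eq_mul]
  rw [magic, ← Real.logb_inv, inv_div, sum_pow 2 even_two two_ne_zero,
    sum_pow 4 (by decide) four_ne_zero, mul_div_mul_left _ _ card_ne_zero, sq_eq, pow_four_eq]
  congr 1
  field_simp
  ring

theorem reducibleCount_compl (hG : IsStabilizerGroup G) (h : IsLogicalTriple G X Y Z)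
    {u v : (ι → Fin 2) → ℂ} (pure : magicState G Y Z = Matrix.vecMulVec u v) {S : Finset ι}
    (count : reducibleCount G S Y Z = 1) : reducibleCount G Sᶜ Y Z = 1 := by
  obtain ⟨a, ha⟩ := hG.exists_natCard_supported S
  obtain ⟨b, hb⟩ := hG.exists_natCard_supported Sᶜ
  have sq_eq : ((1 / √2 : ℝ) : ℂ) ^ 2 = 1 / 2 := by
    rw [← Complex.ofReal_pow, div_pow, Real.sq_sqrt zero_le_two, one_pow]
    norm_num
  have purity := sum_supportedStrings_compl_trace_sq S u v
  simp only [← pure] at purity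
  rw [h.sum_trace_magicState hG (f := (· ^ 2)) (zero_pow two_ne_zero) neg_sq,
    h.sum_trace_magicState hG (f := (· ^ 2)) (zero_pow two_ne_zero) neg_sq, ha, hb, count,
    sq_eq] at purity
  have two_pow_mul : 2 ^ (Sᶜ.card + a) * (2 + 1) =
      2 ^ (S.card + b) * (2 + reducibleCount G Sᶜ Y Z) := by
    rw [← Nat.cast_inj (R := ℂ)]
    push_cast [pow_add, nsmul_eq_mul] at purity ⊢
    linear_combination 2 * purity
  exact eq_one_of_two_pow_mul_eq two_pow_mul (reducibleCount_le_two G Sᶜ Y Z)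

theorem magic_reducedState_cases (hG : IsStabilizerGroup G) (h : IsLogicalTriple G X Y Z)
    {u v : (ι → Fin 2) → ℂ} (pure : magicState G Y Z = Matrix.vecMulVec u v) (A : Finset ι) :
    (LogicalReducible G A Z ∧ ¬ LogicalReducible G Aᶜ Z ∧
        LogicalReducible G A Y ∧ ¬ LogicalReducible G Aᶜ Y ∧
        magic (reducedState A (magicState G Y Z)) = Real.logb 2 (4 / 3)) ∨
      (¬ LogicalReducible G A Z ∧ LogicalReducible G Aᶜ Z ∧
        ¬ LogicalReducible G A Y ∧ LogicalReducible G Aᶜ Y ∧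
        magic (reducedState A (magicState G Y Z)) = 0) ∨
      (¬ LogicalReducible G A Z ∧ ¬ LogicalReducible G Aᶜ Z ∧
        ¬ LogicalReducible G A Y ∧ ¬ LogicalReducible G Aᶜ Y ∧
        magic (reducedState A (magicState G Y Z)) = 0) ∨
      (LogicalReducible G A Z ∧ LogicalReducible G Aᶜ Z ∧
        ¬ LogicalReducible G A Y ∧ ¬ LogicalReducible G Aᶜ Y ∧
        magic (reducedState A (magicState G Y Z)) = Real.logb 2 (6 / 5)) ∨
      (¬ LogicalReducible G A Z ∧ ¬ LogicalReducible G Aᶜ Z ∧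
        LogicalReducible G A Y ∧ LogicalReducible G Aᶜ Y ∧
        magic (reducedState A (magicState G Y Z)) = Real.logb 2 (6 / 5)) := by
  have anti : Y * Z = -(Z * Y) := (neg_eq_iff_eq_neg.2 h.Z_mul_Y).symm
  have not_Y : LogicalReducible G A Z → ¬ LogicalReducible G Aᶜ Y :=
    h.isLogical_Z.not_reducible_compl hG h.isLogical_Y h.Z_mul_Y
  have not_Z : LogicalReducible G A Y → ¬ LogicalReducible G Aᶜ Z :=
    h.isLogical_Y.not_reducible_compl hG h.isLogical_Z anti
  have count : reducibleCount G A Y Z = 1 → reducibleCount G Aᶜ Y Z = 1 :=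
    h.reducibleCount_compl hG pure
  have count_compl : reducibleCount G Aᶜ Y Z = 1 → reducibleCount G A Y Z = 1 := fun count =>
    compl_compl A ▸ h.reducibleCount_compl hG pure count
  rw [h.magic_reducedState hG]
  unfold reducibleCount at count count_compl ⊢
  split_ifs at count count_compl ⊢ <;> simp_all <;> norm_num

end IsLogicalTriple

end MagicState

end MagicGauge

end

theorem theorem1 (L : ℕ) (hL : 1 ≤ L)
    (ψ : (Fin L → Fin 2) → ℂ) (hψ : star ψ ⬝ᵥ ψ = 1)
    (g : Fin (L - 1) → Op (Fin L)) (hg : IsStabilizerGenerators g)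
    (X Y Z : Op (Fin L)) (hlog : IsLogicalTriple (stabGroup g) X Y Z)
    (ρ : Op (Fin L)) (hpure : ρ = Matrix.vecMulVec ψ (star ψ))
    (hρ : ρ = ((1 / 2 ^ L : ℝ) : ℂ) •
      ((1 + ((1 / Real.sqrt 2 : ℝ) : ℂ) • (Z - Y)) * (List.ofFn fun j => 1 + g j).prod))
    (A : Finset (Fin L)) :
    (∃ (nA nB m : ℕ) (a : Fin nA → Op (Fin L)) (b : Fin nB → Op (Fin L)) (h : Fin m → Op (Fin L))
        (gen : Fin nA ⊕ Fin nB ⊕ Fin m → Op (Fin L)) (X' Y' Z' : Op (Fin L)),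
      gen = Sum.elim a (Sum.elim b h) ∧
      L - 1 = nA + nB + m ∧
      -- `a`, `b`, `h` are independent generators of the same stabilizer group
      IsStabilizerGenerators gen ∧ stabGroup gen = stabGroup g ∧
      -- `X'`, `Y'`, `Z'` are equivalent logical operators of the same code
      IsLogicalTriple (stabGroup g) X' Y' Z' ∧
      IsGaugeRepresentative (stabGroup g) A X X' ∧
      IsGaugeRepresentative (stabGroup g) A Y Y' ∧
      IsGaugeRepresentative (stabGroup g) A Z Z' ∧
      -- the factorized form of the state
      ρ = ((1 / 2 : ℂ) • (1 : Op (Fin L)) +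
            ((1 / (2 * Real.sqrt 2) : ℝ) : ℂ) • (Z' - Y')) *
          (List.ofFn fun i => (1 / 2 : ℂ) • (1 + a i)).prod *
          (List.ofFn fun j => (1 / 2 : ℂ) • (1 + b j)).prod *
          (List.ofFn fun k => (1 / 2 : ℂ) • (1 + h k)).prod ∧
      -- `a` lives on `A` only, `b` on the complement of `A` only, `h` on neither
      (∀ i, SupportedOn A (a i) ∧ ¬ GeneratorReducible gen Aᶜ (Sum.inl i)) ∧
      (∀ j, SupportedOn Aᶜ (b j) ∧ ¬ GeneratorReducible gen A (Sum.inr (Sum.inl j))) ∧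
      (∀ k, ¬ GeneratorReducible gen A (Sum.inr (Sum.inr k)) ∧
        ¬ GeneratorReducible gen Aᶜ (Sum.inr (Sum.inr k)))) ∧
    -- exactly one of five cases occurs, and it determines the magic of the subsystem
    ((LogicalReducible (stabGroup g) A Z ∧ ¬ LogicalReducible (stabGroup g) Aᶜ Z ∧
        LogicalReducible (stabGroup g) A Y ∧ ¬ LogicalReducible (stabGroup g) Aᶜ Y ∧
        magic (reducedState A ρ) = Real.logb 2 (4 / 3)) ∨
      (¬ LogicalReducible (stabGroup g) A Z ∧ LogicalReducible (stabGroup g) Aᶜ Z ∧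
        ¬ LogicalReducible (stabGroup g) A Y ∧ LogicalReducible (stabGroup g) Aᶜ Y ∧
        magic (reducedState A ρ) = 0) ∨
      (¬ LogicalReducible (stabGroup g) A Z ∧ ¬ LogicalReducible (stabGroup g) Aᶜ Z ∧
        ¬ LogicalReducible (stabGroup g) A Y ∧ ¬ LogicalReducible (stabGroup g) Aᶜ Y ∧
        magic (reducedState A ρ) = 0) ∨
      (LogicalReducible (stabGroup g) A Z ∧ LogicalReducible (stabGroup g) Aᶜ Z ∧
        ¬ LogicalReducible (stabGroup g) A Y ∧ ¬ LogicalReducible (stabGroup g) Aᶜ Y ∧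
        magic (reducedState A ρ) = Real.logb 2 (6 / 5)) ∨
      (¬ LogicalReducible (stabGroup g) A Z ∧ ¬ LogicalReducible (stabGroup g) Aᶜ Z ∧
        LogicalReducible (stabGroup g) A Y ∧ LogicalReducible (stabGroup g) Aᶜ Y ∧
        magic (reducedState A ρ) = Real.logb 2 (6 / 5))) := by
  have hG := hg.isStabilizerGroup
  have ρ_eq : ρ = magicState (stabGroup g) Y Z := by
    rw [hρ, magicState_stabGroup hg.isIndepInvolutions, Fintype.card_fin]
  obtain ⟨nA, nB, m, a, b, h, card, H⟩ := hg.exists_isBipartiteGenerators A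
  obtain ⟨s, hs, t, ht, gX, gY, gZ⟩ := hlog.exists_gauge_representatives hG A
  rw [Fintype.card_fin] at card
  refine ⟨⟨nA, nB, m, a, b, h, _, X * s, Y * (s * t), Z * t, rfl, card,
    H.isStabilizerGenerators, H.stabGroup_eq, hlog.mul_stabilizers hG hs ht, gX, gY, gZ, ?_,
    fun i => ⟨H.supportedOn_left i, H.not_generatorReducible_right (by simp)⟩,
    fun j => ⟨H.supportedOn_right j, H.not_generatorReducible_left (by simp)⟩,
    fun k => ⟨H.not_generatorReducible_left (by simp), H.not_generatorReducible_right (by simp)⟩⟩,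
    ?_⟩
  · rw [← magicState_eq_mul_prod H.isStabilizerGenerators.isIndepInvolutions
      (by rw [Fintype.card_fin]; omega), H.stabGroup_eq, magicState_mul hG (mul_mem hs ht) ht, ρ_eq]
  · rw [ρ_eq] at hpure ⊢
    exact hlog.magic_reducedState_cases hG hpure A
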